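/- **Conventions.** A $2$-category $\mathcal K$ has finite products if it has chosen finite products in the $\mathbf{CAT}$-enriched sense: an object $1$ and, for all objects $A,B$, an object $A\times B$ with projections, such that composing with the projections gives isomorphisms of categories $\mathcal K(X,1)\cong \mathbf 1$ and $\mathcal K(X,A\times B)\cong\mathcal K(X,A)\times\mathcal K(X,B)$ for every $X$. A *pseudo monoid* in such a $\mathcal K$ is an object $A$ with $1$-cells $i:1\to A$ and $m:A\times A\to A$ and invertible $2$-cells $\alpha:m(m\times 1)\Rightarrow m(1\times m)$, $\lambda:m(i\times 1)\Rightarrow 1_A$, $\rho:m(1\times i)\Rightarrow 1_A$ satisfying the pentagon axiom and the triangle (unit) axiom of a monoidal category. A *strong monoidal morphism* $(A,i,m)\to(A',i',m')$ is a $1$-cell $f:A\to A'$ with invertible $2$-cells $\varphi_0:f i\Rightarrow i'$ and $\varphi_2:f m\Rightarrow m'(f\times f)$ compatible with $\alpha$, $\lambda$ and $\rho$ in the usual way. A *monoidal $2$-cell* $f\Rightarrow g$ is a $2$-cell between the underlying $1$-cells which is compatible with $\varphi_0$ and $\varphi_2$. Pseudo monoids, strong monoidal morphisms and monoidal $2$-cells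 form a $2$-category $\mathrm{PsMon}(\mathcal K)$. It again has finite products, with the componentwise structure, so that the construction can be iterated. The forgetful $2$-functor $\mathrm{PsMon}(\mathcal K)\to\mathcal K$ sends a pseudo monoid, a strong monoidal morphism and a monoidal $2$-cell to the underlying object, $1$-cell and $2$-cell. A $2$-functor $F:\mathcal A\to\mathcal B$ is a *$2$-equivalence* (an equivalence in the $\mathbf{CAT}$-enriched sense) if there are a $2$-functor $G:\mathcal B\to\mathcal A$ and $2$-natural isomorphisms $GF\cong 1_{\mathcal A}$ and $FG\cong 1_{\mathcal B}$. **Proposition (Eckmann–Hilton stabilisation).** Let $\mathcal K$ be a $2$-category with finite products. Then the forgetful $2$-functor $$\mathrm{PsMon}(\mathrm{PsMon}(\mathrm{PsMon}(\mathrm{PsMon}(\mathcal K))))\longrightarrow \mathrm{PsMon}(\mathrm{PsMon}(\mathrm{PsMon}(\mathcal K))),$$ which forgets the outermost pseudo monoid structure, is a $2$-equivalence. -/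

import Mathlib

set_option linter.unusedSimpArgs false

open CategoryTheory Bicategory

universe w v u

namespace TwoCat

/-- Chosen finite products in a `2`-category, in the `Cat`-enriched sense: a terminal object
`one` and binary products `prod A B` such that composition with the projections gives isomorphisms
of categories `K(X, one) ≅ 1` and `K(X, prod A B) ≅ K(X, A) × K(X, B)`. -/
class FiniteProducts (K : Type u) [Bicategory.{w, v} K] where
  one : K
  bang (X : K) : X ⟶ one
  bang_uniq {X : K} (f : X ⟶ one) : f = bang X
  bang_ext₂ {X : K} {f g : X ⟶ one} (η θ : f ⟶ g) : η = θ
  prod : K → K → K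
  fst (A B : K) : prod A B ⟶ A
  snd (A B : K) : prod A B ⟶ B
  pair {X A B : K} (f : X ⟶ A) (g : X ⟶ B) : X ⟶ prod A B
  pair_fst {X A B : K} (f : X ⟶ A) (g : X ⟶ B) : pair f g ≫ fst A B = f
  pair_snd {X A B : K} (f : X ⟶ A) (g : X ⟶ B) : pair f g ≫ snd A B = g
  hom_ext {X A B : K} {h k : X ⟶ prod A B} :
    h ≫ fst A B = k ≫ fst A B → h ≫ snd A B = k ≫ snd A B → h = k
  lift₂ {X A B : K} {h k : X ⟶ prod A B} (η : h ≫ fst A B ⟶ k ≫ fst A B)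
    (θ : h ≫ snd A B ⟶ k ≫ snd A B) : h ⟶ k
  lift₂_fst {X A B : K} {h k : X ⟶ prod A B} (η : h ≫ fst A B ⟶ k ≫ fst A B)
    (θ : h ≫ snd A B ⟶ k ≫ snd A B) : lift₂ η θ ▷ fst A B = η
  lift₂_snd {X A B : K} {h k : X ⟶ prod A B} (η : h ≫ fst A B ⟶ k ≫ fst A B)
    (θ : h ≫ snd A B ⟶ k ≫ snd A B) : lift₂ η θ ▷ snd A B = θ
  hom_ext₂ {X A B : K} {h k : X ⟶ prod A B} {ζ ξ : h ⟶ k} :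
    ζ ▷ fst A B = ξ ▷ fst A B → ζ ▷ snd A B = ξ ▷ snd A B → ζ = ξ

open FiniteProducts

attribute [simp] pair_fst pair_snd lift₂_fst lift₂_snd

section Cells

variable {K : Type u} [Bicategory.{w, v} K]

/-- Whiskering along equal `1`-cells. -/
theorem whiskerLeft_congr {X A B : K} {h h' : X ⟶ A} (e : h = h') {f g : A ⟶ B} (η : f ⟶ g) :
    h ◁ η = eqToHom (by rw [e]) ≫ h' ◁ η ≫ eqToHom (by rw [e]) := by
  subst e; simp

theorem whiskerRight_congr {X A B : K} {h h' : A ⟶ B} (e : h = h') {f g : X ⟶ A} (η : f ⟶ g) :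
    η ▷ h = eqToHom (by rw [e]) ≫ η ▷ h' ≫ eqToHom (by rw [e]) := by
  subst e; simp

theorem id_conj {A B : K} {f g : A ⟶ B} (e : f = g) :
    𝟙 f = eqToHom e ≫ 𝟙 g ≫ eqToHom e.symm := by
  subst e; simp

variable [Bicategory.Strict K]

theorem whiskerLeft_whiskerLeft {X Y A B : K} {h : X ⟶ Y} {k : Y ⟶ A} {l : X ⟶ A}
    (e : h ≫ k = l) {f g : A ⟶ B} (η : f ⟶ g) :
    h ◁ (k ◁ η) = eqToHom (by rw [← e, Strict.assoc]) ≫ l ◁ η ≫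
      eqToHom (by rw [← e, Strict.assoc]) := by
  subst e; simp [Strict.associator_eqToIso]

theorem whiskerRight_whiskerRight {X A B C : K} {f g : X ⟶ A} (η : f ⟶ g) {h : A ⟶ B}
    {k : B ⟶ C} {l : A ⟶ C} (e : h ≫ k = l) :
    (η ▷ h) ▷ k = eqToHom (by rw [← e, Strict.assoc]) ≫ η ▷ l ≫
      eqToHom (by rw [← e, Strict.assoc]) := by
  subst e; simp [Strict.associator_eqToIso]

theorem whiskerRight_comp' {X A B C : K} {f g : X ⟶ A} (η : f ⟶ g) (h : A ⟶ B) (k : B ⟶ C) :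
    η ▷ (h ≫ k) = eqToHom (Strict.assoc f h k).symm ≫ η ▷ h ▷ k ≫
      eqToHom (Strict.assoc g h k) := by
  simp [Strict.associator_eqToIso]

theorem comp_whiskerLeft' {X Y A B : K} (h : X ⟶ Y) (k : Y ⟶ A) {f g : A ⟶ B} (η : f ⟶ g) :
    (h ≫ k) ◁ η = eqToHom (Strict.assoc h k f) ≫ h ◁ k ◁ η ≫
      eqToHom (Strict.assoc h k g).symm := by
  simp [Strict.associator_eqToIso]

theorem whisker_assoc' {X A B C : K} (h : X ⟶ A) {f g : A ⟶ B} (η : f ⟶ g) (k : B ⟶ C) :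
    (h ◁ η) ▷ k = eqToHom (Strict.assoc h f k) ≫ h ◁ (η ▷ k) ≫
      eqToHom (Strict.assoc h g k).symm := by
  simp [Strict.associator_eqToIso]

theorem whiskerLeft_whiskerRight {X A B C : K} (h : X ⟶ A) {f g : A ⟶ B} (η : f ⟶ g)
    (k : B ⟶ C) :
    h ◁ (η ▷ k) = eqToHom (Strict.assoc h f k).symm ≫ (h ◁ η) ▷ k ≫
      eqToHom (Strict.assoc h g k) := by
  simp [Strict.associator_eqToIso]

theorem id_whiskerLeft' {A B : K} {f g : A ⟶ B} (η : f ⟶ g) :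
    𝟙 A ◁ η = eqToHom (Strict.id_comp f) ≫ η ≫ eqToHom (Strict.id_comp g).symm := by
  simp [Strict.leftUnitor_eqToIso]

theorem whiskerRight_id' {A B : K} {f g : A ⟶ B} (η : f ⟶ g) :
    η ▷ 𝟙 B = eqToHom (Strict.comp_id f) ≫ η ≫ eqToHom (Strict.comp_id g).symm := by
  simp [Strict.rightUnitor_eqToIso]

end Cells

section Products

variable {K : Type u} [Bicategory.{w, v} K] [FiniteProducts K]

/-- The `2`-cell between pairings whose components are `η` and `θ`. -/
def pairMap {X A B : K} {f f' : X ⟶ A} {g g' : X ⟶ B} (η : f ⟶ f') (θ : g ⟶ g') :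
    pair f g ⟶ pair f' g' :=
  lift₂ (eqToHom (pair_fst f g) ≫ η ≫ eqToHom (pair_fst f' g').symm)
    (eqToHom (pair_snd f g) ≫ θ ≫ eqToHom (pair_snd f' g').symm)

@[simp]
theorem pairMap_fst {X A B : K} {f f' : X ⟶ A} {g g' : X ⟶ B} (η : f ⟶ f') (θ : g ⟶ g') :
    pairMap η θ ▷ fst A B = eqToHom (pair_fst f g) ≫ η ≫ eqToHom (pair_fst f' g').symm :=
  lift₂_fst _ _

@[simp]
theorem pairMap_snd {X A B : K} {f f' : X ⟶ A} {g g' : X ⟶ B} (η : f ⟶ f') (θ : g ⟶ g') :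
    pairMap η θ ▷ snd A B = eqToHom (pair_snd f g) ≫ θ ≫ eqToHom (pair_snd f' g').symm :=
  lift₂_snd _ _

@[simp]
theorem pairMap_id {X A B : K} (f : X ⟶ A) (g : X ⟶ B) : pairMap (𝟙 f) (𝟙 g) = 𝟙 (pair f g) :=
  hom_ext₂ (by simp) (by simp)

@[simp]
theorem pairMap_eqToHom {X A B : K} {f f' : X ⟶ A} {g g' : X ⟶ B} (e : f = f') (e' : g = g') :
    pairMap (eqToHom e) (eqToHom e') = eqToHom (by rw [e, e']) := by
  subst e e'; simp

@[simp]
theorem pairMap_comp {X A B : K} {f f' f'' : X ⟶ A} {g g' g'' : X ⟶ B} (η : f ⟶ f')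
    (η' : f' ⟶ f'') (θ : g ⟶ g') (θ' : g' ⟶ g'') :
    pairMap (η ≫ η') (θ ≫ θ') = pairMap η θ ≫ pairMap η' θ' :=
  hom_ext₂ (by simp) (by simp)

/-- The tensor product of two generalised elements, for a binary operation `m`. -/
def ten {A : K} (m : prod A A ⟶ A) {X : K} (x y : X ⟶ A) : X ⟶ A :=
  pair x y ≫ m

/-- The tensor product of two `2`-cells between generalised elements. -/
def tenMap {A : K} (m : prod A A ⟶ A) {X : K} {x x' y y' : X ⟶ A} (η : x ⟶ x') (θ : y ⟶ y') :
    ten m x y ⟶ ten m x' y' :=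
  pairMap η θ ▷ m

@[simp]
theorem tenMap_id {A : K} (m : prod A A ⟶ A) {X : K} (x y : X ⟶ A) :
    tenMap m (𝟙 x) (𝟙 y) = 𝟙 (ten m x y) := by
  simp [tenMap, ten]

@[simp]
theorem tenMap_eqToHom {A : K} (m : prod A A ⟶ A) {X : K} {x x' y y' : X ⟶ A} (e : x = x')
    (e' : y = y') : tenMap m (eqToHom e) (eqToHom e') = eqToHom (by rw [e, e']) := by
  subst e e'; simp

@[simp]
theorem tenMap_eqToHom_left {A : K} (m : prod A A ⟶ A) {X : K} {x x' : X ⟶ A} (y : X ⟶ A)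
    (e : x = x') : tenMap m (eqToHom e) (𝟙 y) = eqToHom (by rw [e]) := by
  subst e; simp

@[simp]
theorem tenMap_eqToHom_right {A : K} (m : prod A A ⟶ A) {X : K} (x : X ⟶ A) {y y' : X ⟶ A}
    (e : y = y') : tenMap m (𝟙 x) (eqToHom e) = eqToHom (by rw [e]) := by
  subst e; simp

theorem tenMap_conj {A : K} (m : prod A A ⟶ A) {X : K} {x x' y y' a a' b b' : X ⟶ A}
    (e₁ : a = x) (η : x ⟶ x') (e₂ : x' = a') (e₃ : b = y) (θ : y ⟶ y') (e₄ : y' = b') :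
    tenMap m (eqToHom e₁ ≫ η ≫ eqToHom e₂) (eqToHom e₃ ≫ θ ≫ eqToHom e₄) =
      eqToHom (by rw [e₁, e₃]) ≫ tenMap m η θ ≫ eqToHom (by rw [e₂, e₄]) := by
  subst e₁ e₂ e₃ e₄; simp

theorem tenMap_conj_left {A : K} (m : prod A A ⟶ A) {X : K} {x x' y a a' : X ⟶ A}
    (e₁ : a = x) (η : x ⟶ x') (e₂ : x' = a') :
    tenMap m (eqToHom e₁ ≫ η ≫ eqToHom e₂) (𝟙 y) =
      eqToHom (by rw [e₁]) ≫ tenMap m η (𝟙 y) ≫ eqToHom (by rw [e₂]) := by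
  subst e₁ e₂; simp

theorem tenMap_conj_right {A : K} (m : prod A A ⟶ A) {X : K} {x y y' b b' : X ⟶ A}
    (e₃ : b = y) (θ : y ⟶ y') (e₄ : y' = b') :
    tenMap m (𝟙 x) (eqToHom e₃ ≫ θ ≫ eqToHom e₄) =
      eqToHom (by rw [e₃]) ≫ tenMap m (𝟙 x) θ ≫ eqToHom (by rw [e₄]) := by
  subst e₃ e₄; simp

theorem tenMap_comp {A : K} (m : prod A A ⟶ A) {X : K} {x x' x'' y y' y'' : X ⟶ A}
    (η : x ⟶ x') (η' : x' ⟶ x'') (θ : y ⟶ y') (θ' : y' ⟶ y'') :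
    tenMap m (η ≫ η') (θ ≫ θ') = tenMap m η θ ≫ tenMap m η' θ' := by
  simp only [tenMap, pairMap_comp, comp_whiskerRight]
  rfl

theorem tenMap_comp_left {A : K} (m : prod A A ⟶ A) {X : K} {x x' x'' : X ⟶ A} (y : X ⟶ A)
    (η : x ⟶ x') (η' : x' ⟶ x'')  :
    tenMap m (η ≫ η') (𝟙 y) = tenMap m η (𝟙 y) ≫ tenMap m η' (𝟙 y) := by
  simp [← tenMap_comp]

theorem tenMap_comp_right {A : K} (m : prod A A ⟶ A) {X : K} (x : X ⟶ A) {y y' y'' : X ⟶ A}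
    (η : y ⟶ y') (η' : y' ⟶ y'')  :
    tenMap m (𝟙 x) (η ≫ η') = tenMap m (𝟙 x) η ≫ tenMap m (𝟙 x) η' := by
  simp [← tenMap_comp]

variable [Bicategory.Strict K]

theorem comp_pair {Y X A B : K} (h : Y ⟶ X) (f : X ⟶ A) (g : X ⟶ B) :
    h ≫ pair f g = pair (h ≫ f) (h ≫ g) :=
  hom_ext (by simp) (by simp)

theorem pair_fst_comp {X A B C : K} (f : X ⟶ A) (g : X ⟶ B) (h : A ⟶ C) :
    pair f g ≫ fst A B ≫ h = f ≫ h := by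
  rw [← Strict.assoc, pair_fst]

theorem pair_snd_comp {X A B C : K} (f : X ⟶ A) (g : X ⟶ B) (h : B ⟶ C) :
    pair f g ≫ snd A B ≫ h = g ≫ h := by
  rw [← Strict.assoc, pair_snd]

theorem pair_eta (A B : K) : pair (fst A B) (snd A B) = 𝟙 (prod A B) :=
  hom_ext (by simp) (by simp)

theorem comp_ten {A : K} (m : prod A A ⟶ A) {X Y : K} (h : Y ⟶ X) (x y : X ⟶ A) :
    h ≫ ten m x y = ten m (h ≫ x) (h ≫ y) := by
  simp only [ten, ← Strict.assoc, comp_pair]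

theorem ten_comp {A B : K} (m : prod A A ⟶ A) {X : K} (x y : X ⟶ A) (f : A ⟶ B) :
    ten m x y ≫ f = pair x y ≫ m ≫ f :=
  Strict.assoc _ _ _

theorem tenMap_whiskerRight {A B : K} (m : prod A A ⟶ A) {X : K} {x x' y y' : X ⟶ A}
    (η : x ⟶ x') (θ : y ⟶ y') (f : A ⟶ B) :
    tenMap m η θ ▷ f = eqToHom (ten_comp m x y f) ≫ pairMap η θ ▷ (m ≫ f) ≫
      eqToHom (ten_comp m x' y' f).symm :=
  whiskerRight_whiskerRight (pairMap η θ) (rfl : m ≫ f = m ≫ f)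

theorem comp_bang {X Y : K} (h : Y ⟶ X) : h ≫ bang X = bang Y := bang_uniq _

theorem whiskerRight_bang_comp {X Y A : K} {h k : Y ⟶ X} (ζ : h ⟶ k) (i : one ⟶ A) :
    ζ ▷ (bang X ≫ i) = eqToHom (by rw [← Strict.assoc, comp_bang]) ≫ 𝟙 (bang Y ≫ i) ≫
      eqToHom (by rw [← Strict.assoc, comp_bang]) := by
  have : ζ ▷ bang X = eqToHom (by rw [comp_bang, comp_bang]) := bang_ext₂ _ _
  simp [this, Strict.associator_eqToIso]

theorem whiskerLeft_pairMap {Y X A B : K} (h : Y ⟶ X) {f f' : X ⟶ A} {g g' : X ⟶ B}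
    (η : f ⟶ f') (θ : g ⟶ g') :
    h ◁ pairMap η θ = eqToHom (comp_pair h f g) ≫ pairMap (h ◁ η) (h ◁ θ) ≫
      eqToHom (comp_pair h f' g').symm :=
  hom_ext₂ (by simp [Strict.associator_eqToIso]) (by simp [Strict.associator_eqToIso])

theorem whiskerLeft_tenMap {A : K} (m : prod A A ⟶ A) {X Y : K} (h : Y ⟶ X)
    {x x' y y' : X ⟶ A} (η : x ⟶ x') (θ : y ⟶ y') :
    h ◁ tenMap m η θ = eqToHom (comp_ten m h x y) ≫ tenMap m (h ◁ η) (h ◁ θ) ≫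
      eqToHom (comp_ten m h x' y').symm := by
  change h ◁ (pairMap η θ ▷ m) = _ ≫ (pairMap _ _ ▷ m) ≫ _
  rw [whiskerLeft_whiskerRight, whiskerLeft_pairMap]
  simp [ten]

theorem whiskerRight_pair {Y X A B : K} {h k : Y ⟶ X} (ζ : h ⟶ k) (f : X ⟶ A) (g : X ⟶ B) :
    ζ ▷ pair f g = eqToHom (comp_pair h f g) ≫ pairMap (ζ ▷ f) (ζ ▷ g) ≫
      eqToHom (comp_pair k f g).symm :=
  hom_ext₂ (by simp [whiskerRight_whiskerRight ζ (pair_fst f g)])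
    (by simp [whiskerRight_whiskerRight ζ (pair_snd f g)])

theorem whiskerRight_ten {A : K} (m : prod A A ⟶ A) {Y X : K} {h k : Y ⟶ X} (ζ : h ⟶ k)
    (x y : X ⟶ A) :
    ζ ▷ ten m x y = eqToHom (comp_ten m h x y) ≫ tenMap m (ζ ▷ x) (ζ ▷ y) ≫
      eqToHom (comp_ten m k x y).symm := by
  change ζ ▷ (pair x y ≫ m) = _ ≫ (pairMap _ _ ▷ m) ≫ _
  rw [whiskerRight_comp]
  simp [whiskerRight_pair, Strict.associator_eqToIso, ten]

theorem pairMap_whiskerRight_fst_comp {X A B C : K} {f f' : X ⟶ A} {g g' : X ⟶ B} (η : f ⟶ f')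
    (θ : g ⟶ g') (h : A ⟶ C) :
    pairMap η θ ▷ (fst A B ≫ h) = eqToHom (pair_fst_comp f g h) ≫ η ▷ h ≫
      eqToHom (pair_fst_comp f' g' h).symm := by
  simp [Strict.associator_eqToIso]

theorem pairMap_whiskerRight_snd_comp {X A B C : K} {f f' : X ⟶ A} {g g' : X ⟶ B} (η : f ⟶ f')
    (θ : g ⟶ g') (h : B ⟶ C) :
    pairMap η θ ▷ (snd A B ≫ h) = eqToHom (pair_snd_comp f g h) ≫ θ ▷ h ≫
      eqToHom (pair_snd_comp f' g' h).symm := by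
  simp [Strict.associator_eqToIso]

end Products

/-- The data `(i, m, α, λ, ρ)` of a pseudo monoid on an object `obj`; the invertible `2`-cells are
`α : m (m × 1) ⇒ m (1 × m)`, `λ : m (i × 1) ⇒ 1` and `ρ : m (1 × i) ⇒ 1`. -/
structure PsMonData (K : Type u) [Bicategory.{w, v} K] [FiniteProducts K] where
  obj : K
  unit : one ⟶ obj
  mul : prod obj obj ⟶ obj
  assoc :
    ten mul (ten mul (fst obj (prod obj obj)) (snd obj (prod obj obj) ≫ fst obj obj))
        (snd obj (prod obj obj) ≫ snd obj obj) ≅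
      ten mul (fst obj (prod obj obj))
        (ten mul (snd obj (prod obj obj) ≫ fst obj obj) (snd obj (prod obj obj) ≫ snd obj obj))
  leftUnit : ten mul (bang obj ≫ unit) (𝟙 obj) ≅ 𝟙 obj
  rightUnit : ten mul (𝟙 obj) (bang obj ≫ unit) ≅ 𝟙 obj

namespace PsMonData

variable {K : Type u} [Bicategory.{w, v} K] [Bicategory.Strict K] [FiniteProducts K]
  (M : PsMonData K) {X Y : K}

theorem comp_ten_ten_left (x y z : X ⟶ M.obj) :
    pair x (pair y z) ≫ ten M.mul
      (ten M.mul (fst M.obj (prod M.obj M.obj)) (snd M.obj (prod M.obj M.obj) ≫ fst M.obj M.obj))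
        (snd M.obj (prod M.obj M.obj) ≫ snd M.obj M.obj) = ten M.mul (ten M.mul x y) z := by
  simp only [comp_ten, pair_fst, pair_snd_comp, pair_snd]

theorem comp_ten_ten_right (x y z : X ⟶ M.obj) :
    pair x (pair y z) ≫ ten M.mul (fst M.obj (prod M.obj M.obj))
      (ten M.mul (snd M.obj (prod M.obj M.obj) ≫ fst M.obj M.obj)
        (snd M.obj (prod M.obj M.obj) ≫ snd M.obj M.obj)) = ten M.mul x (ten M.mul y z) := by
  simp only [comp_ten, pair_fst, pair_snd_comp, pair_snd]

theorem comp_ten_unit_left (x : X ⟶ M.obj) :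
    x ≫ ten M.mul (bang M.obj ≫ M.unit) (𝟙 M.obj) = ten M.mul (bang X ≫ M.unit) x := by
  simp only [comp_ten, ← Strict.assoc, comp_bang, Strict.comp_id]

theorem comp_ten_unit_right (x : X ⟶ M.obj) :
    x ≫ ten M.mul (𝟙 M.obj) (bang M.obj ≫ M.unit) = ten M.mul x (bang X ≫ M.unit) := by
  simp only [comp_ten, ← Strict.assoc, comp_bang, Strict.comp_id]

/-- The component of `α` at generalised elements `x`, `y`, `z`: the whiskering of `α` with
`(x, y, z) : X ⟶ A × (A × A)`. The `eqToIso`s are identity `2`-cells. -/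
def assocAt (x y z : X ⟶ M.obj) :
    ten M.mul (ten M.mul x y) z ≅ ten M.mul x (ten M.mul y z) :=
  eqToIso (M.comp_ten_ten_left x y z).symm ≪≫ whiskerLeftIso (pair x (pair y z)) M.assoc ≪≫
    eqToIso (M.comp_ten_ten_right x y z)

/-- The component of `λ` at a generalised element. -/
def leftAt (x : X ⟶ M.obj) : ten M.mul (bang X ≫ M.unit) x ≅ x :=
  eqToIso (M.comp_ten_unit_left x).symm ≪≫ whiskerLeftIso x M.leftUnit ≪≫
    eqToIso (Strict.comp_id x)

/-- The component of `ρ` at a generalised element. -/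
def rightAt (x : X ⟶ M.obj) : ten M.mul x (bang X ≫ M.unit) ≅ x :=
  eqToIso (M.comp_ten_unit_right x).symm ≪≫ whiskerLeftIso x M.rightUnit ≪≫
    eqToIso (Strict.comp_id x)

theorem assocAt_naturality {x x' y y' z z' : X ⟶ M.obj} (η : x ⟶ x') (θ : y ⟶ y')
    (κ : z ⟶ z') :
    tenMap M.mul (tenMap M.mul η θ) κ ≫ (M.assocAt x' y' z').hom =
      (M.assocAt x y z).hom ≫ tenMap M.mul η (tenMap M.mul θ κ) := by
  have := whisker_exchange (pairMap η (pairMap θ κ)) M.assoc.hom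
  simp only [whiskerRight_ten, pairMap_whiskerRight_snd_comp,
    pairMap_fst, pairMap_snd, tenMap_conj, Category.assoc, eqToHom_trans,
    eqToHom_trans_assoc] at this
  rw [← cancel_epi (eqToHom (M.comp_ten_ten_left x y z)),
    ← cancel_mono (eqToHom (M.comp_ten_ten_right x' y' z').symm)]
  simpa [assocAt] using this.symm

theorem leftAt_naturality {x x' : X ⟶ M.obj} (η : x ⟶ x') :
    tenMap M.mul (𝟙 (bang X ≫ M.unit)) η ≫ (M.leftAt x').hom = (M.leftAt x).hom ≫ η := by
  have := whisker_exchange η M.leftUnit.hom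
  simp only [whiskerRight_ten, whiskerRight_bang_comp, whiskerRight_id', tenMap_conj,
    Category.assoc, eqToHom_trans, eqToHom_trans_assoc] at this
  rw [← cancel_epi (eqToHom (M.comp_ten_unit_left x)),
    ← cancel_mono (eqToHom (Strict.comp_id x').symm)]
  simpa [leftAt] using this.symm

theorem rightAt_naturality {x x' : X ⟶ M.obj} (η : x ⟶ x') :
    tenMap M.mul η (𝟙 (bang X ≫ M.unit)) ≫ (M.rightAt x').hom = (M.rightAt x).hom ≫ η := by
  have := whisker_exchange η M.rightUnit.hom
  simp only [whiskerRight_ten, whiskerRight_bang_comp, whiskerRight_id', tenMap_conj,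
    Category.assoc, eqToHom_trans, eqToHom_trans_assoc] at this
  rw [← cancel_epi (eqToHom (M.comp_ten_unit_right x)),
    ← cancel_mono (eqToHom (Strict.comp_id x').symm)]
  simpa [rightAt] using this.symm

theorem assocAt_congr {x x' y y' z z' : X ⟶ M.obj} (ex : x = x') (ey : y = y') (ez : z = z') :
    (M.assocAt x y z).hom = eqToHom (by rw [ex, ey, ez]) ≫ (M.assocAt x' y' z').hom ≫
      eqToHom (by rw [ex, ey, ez]) := by
  subst ex ey ez; simp

theorem leftAt_congr {x x' : X ⟶ M.obj} (e : x = x') :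
    (M.leftAt x).hom = eqToHom (by rw [e]) ≫ (M.leftAt x').hom ≫ eqToHom e.symm := by
  subst e; simp

theorem rightAt_congr {x x' : X ⟶ M.obj} (e : x = x') :
    (M.rightAt x).hom = eqToHom (by rw [e]) ≫ (M.rightAt x').hom ≫ eqToHom e.symm := by
  subst e; simp

theorem whiskerLeft_assocAt (h : Y ⟶ X) {x y z : X ⟶ M.obj} {x' y' z' : Y ⟶ M.obj}
    (ex : h ≫ x = x') (ey : h ≫ y = y') (ez : h ≫ z = z') :
    h ◁ (M.assocAt x y z).hom = eqToHom (by simp only [comp_ten, ex, ey, ez]) ≫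
      (M.assocAt x' y' z').hom ≫ eqToHom (by simp only [comp_ten, ex, ey, ez]) := by
  subst ex ey ez
  have e : h ≫ pair x (pair y z) = pair (h ≫ x) (pair (h ≫ y) (h ≫ z)) := by
    simp only [comp_pair]
  simp [assocAt, whiskerLeft_whiskerLeft e]

theorem whiskerLeft_leftAt (h : Y ⟶ X) {x : X ⟶ M.obj} {x' : Y ⟶ M.obj} (ex : h ≫ x = x') :
    h ◁ (M.leftAt x).hom = eqToHom (by simp only [comp_ten, ← Strict.assoc, comp_bang, ex]) ≫
      (M.leftAt x').hom ≫ eqToHom ex.symm := by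
  subst ex
  simp [leftAt, whiskerLeft_whiskerLeft (rfl : h ≫ x = h ≫ x), -comp_whiskerLeft]

theorem whiskerLeft_rightAt (h : Y ⟶ X) {x : X ⟶ M.obj} {x' : Y ⟶ M.obj} (ex : h ≫ x = x') :
    h ◁ (M.rightAt x).hom = eqToHom (by simp only [comp_ten, ← Strict.assoc, comp_bang, ex]) ≫
      (M.rightAt x').hom ≫ eqToHom ex.symm := by
  subst ex
  simp [rightAt, whiskerLeft_whiskerLeft (rfl : h ≫ x = h ≫ x), -comp_whiskerLeft]

theorem comp_unit (h : Y ⟶ X) : h ≫ bang X ≫ M.unit = bang Y ≫ M.unit := by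
  rw [← Strict.assoc, comp_bang]

/-- The pentagon axiom evaluated at four generalised elements. -/
def PentagonAt (w x y z : X ⟶ M.obj) : Prop :=
  tenMap M.mul (M.assocAt w x y).hom (𝟙 z) ≫ (M.assocAt w (ten M.mul x y) z).hom ≫
      tenMap M.mul (𝟙 w) (M.assocAt x y z).hom =
    (M.assocAt (ten M.mul w x) y z).hom ≫ (M.assocAt w x (ten M.mul y z)).hom

/-- The unit axiom evaluated at two generalised elements. -/
def TriangleAt (x y : X ⟶ M.obj) : Prop :=
  (M.assocAt x (bang X ≫ M.unit) y).hom ≫ tenMap M.mul (𝟙 x) (M.leftAt y).hom =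
    tenMap M.mul (M.rightAt x).hom (𝟙 y)

variable {M}

theorem PentagonAt.whisker {w x y z : X ⟶ M.obj} (H : M.PentagonAt w x y z) (h : Y ⟶ X) :
    M.PentagonAt (h ≫ w) (h ≫ x) (h ≫ y) (h ≫ z) := by
  have := congrArg (h ◁ ·) H
  simp only [whiskerLeft_comp, whiskerLeft_tenMap, whiskerLeft_id,
    whiskerLeft_assocAt M h (rfl : h ≫ w = h ≫ w) (rfl : h ≫ x = h ≫ x) (rfl : h ≫ y = h ≫ y),
    whiskerLeft_assocAt M h (rfl : h ≫ x = h ≫ x) (rfl : h ≫ y = h ≫ y) (rfl : h ≫ z = h ≫ z),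
    whiskerLeft_assocAt M h (rfl : h ≫ w = h ≫ w) (comp_ten M.mul h x y) (rfl : h ≫ z = h ≫ z),
    whiskerLeft_assocAt M h (comp_ten M.mul h w x) (rfl : h ≫ y = h ≫ y) (rfl : h ≫ z = h ≫ z),
    whiskerLeft_assocAt M h (rfl : h ≫ w = h ≫ w) (rfl : h ≫ x = h ≫ x) (comp_ten M.mul h y z),
    tenMap_conj_left, tenMap_conj_right] at this
  simp only [Category.assoc, eqToHom_trans, eqToHom_trans_assoc, eqToHom_refl, Category.id_comp,
    Category.comp_id, cancel_epi] at this
  simp only [← Category.assoc, cancel_mono] at this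
  simpa [PentagonAt] using this

theorem TriangleAt.whisker {x y : X ⟶ M.obj} (H : M.TriangleAt x y) (h : Y ⟶ X) :
    M.TriangleAt (h ≫ x) (h ≫ y) := by
  have := congrArg (h ◁ ·) H
  simp only [whiskerLeft_comp, whiskerLeft_tenMap, whiskerLeft_id,
    whiskerLeft_assocAt M h (rfl : h ≫ x = h ≫ x) (M.comp_unit h) (rfl : h ≫ y = h ≫ y),
    whiskerLeft_leftAt M h (rfl : h ≫ y = h ≫ y), whiskerLeft_rightAt M h (rfl : h ≫ x = h ≫ x),
    tenMap_conj_left, tenMap_conj_right] at this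
  simp only [Category.assoc, eqToHom_trans, eqToHom_trans_assoc, eqToHom_refl, Category.id_comp,
    Category.comp_id, cancel_epi] at this
  simp only [← Category.assoc, cancel_mono] at this
  simpa [TriangleAt] using this

end PsMonData

/-- A pseudo monoid: the axioms are equations of `2`-cells between `1`-cells out of
`A × (A × (A × A))` and `A × A`. -/
structure PsMon (K : Type u) [Bicategory.{w, v} K] [Bicategory.Strict K] [FiniteProducts K]
    extends PsMonData K where
  pentagon :
    toPsMonData.PentagonAt (fst obj (prod obj (prod obj obj)))
      (snd obj (prod obj (prod obj obj)) ≫ fst obj (prod obj obj))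
      (snd obj (prod obj (prod obj obj)) ≫ snd obj (prod obj obj) ≫ fst obj obj)
      (snd obj (prod obj (prod obj obj)) ≫ snd obj (prod obj obj) ≫ snd obj obj)
  triangle : toPsMonData.TriangleAt (fst obj obj) (snd obj obj)

section

variable {K : Type u} [Bicategory.{w, v} K] [Bicategory.Strict K] [FiniteProducts K]

theorem PsMon.pentagonAt (M : PsMon K) {X : K} (w x y z : X ⟶ M.obj) : M.PentagonAt w x y z := by
  have := M.pentagon.whisker (pair w (pair x (pair y z)))
  simpa only [pair_fst, pair_snd_comp, pair_snd] using this

theorem PsMon.triangleAt (M : PsMon K) {X : K} (x y : X ⟶ M.obj) : M.TriangleAt x y := by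
  have := M.triangle.whisker (pair x y)
  simpa only [pair_fst, pair_snd] using this

end

/-- The data `(f, φ₀, φ₂)` of a strong monoidal morphism: `φ₀ : f i ⇒ i'` and
`φ₂ : f m ⇒ m' (f × f)` are invertible `2`-cells. -/
structure MonHomData {K : Type u} [Bicategory.{w, v} K] [FiniteProducts K]
    (M N : PsMonData K) where
  hom : M.obj ⟶ N.obj
  unitIso : M.unit ≫ hom ≅ N.unit
  mulIso : M.mul ≫ hom ≅ ten N.mul (fst M.obj M.obj ≫ hom) (snd M.obj M.obj ≫ hom)

namespace MonHomData

variable {K : Type u} [Bicategory.{w, v} K] [Bicategory.Strict K] [FiniteProducts K]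
  {M N : PsMonData K} (f : MonHomData M N) {X Y : K}

theorem comp_ten_hom (x y : X ⟶ M.obj) :
    pair x y ≫ ten N.mul (fst M.obj M.obj ≫ f.hom) (snd M.obj M.obj ≫ f.hom) =
      ten N.mul (x ≫ f.hom) (y ≫ f.hom) := by
  simp only [comp_ten, pair_fst_comp, pair_snd_comp]

/-- The component of `φ₀` at an object `X`. -/
def unitAt (X : K) : (bang X ≫ M.unit) ≫ f.hom ≅ bang X ≫ N.unit :=
  eqToIso (Strict.assoc _ _ _) ≪≫ whiskerLeftIso (bang X) f.unitIso

/-- The component of `φ₂` at generalised elements `x`, `y`. -/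
def mulAt (x y : X ⟶ M.obj) :
    ten M.mul x y ≫ f.hom ≅ ten N.mul (x ≫ f.hom) (y ≫ f.hom) :=
  eqToIso (ten_comp M.mul x y f.hom) ≪≫ whiskerLeftIso (pair x y) f.mulIso ≪≫
    eqToIso (f.comp_ten_hom x y)

theorem mulAt_naturality {x x' y y' : X ⟶ M.obj} (η : x ⟶ x') (θ : y ⟶ y') :
    tenMap M.mul η θ ▷ f.hom ≫ (f.mulAt x' y').hom =
      (f.mulAt x y).hom ≫ tenMap N.mul (η ▷ f.hom) (θ ▷ f.hom) := by
  have := whisker_exchange (pairMap η θ) f.mulIso.hom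
  simp only [whiskerRight_ten, pairMap_whiskerRight_fst_comp, pairMap_whiskerRight_snd_comp,
    tenMap_conj, Category.assoc, eqToHom_trans, eqToHom_trans_assoc] at this
  rw [tenMap_whiskerRight, ← cancel_mono (eqToHom (f.comp_ten_hom x' y').symm)]
  simp only [mulAt, Iso.trans_hom, eqToIso.hom, whiskerLeftIso_hom, Category.assoc,
    eqToHom_trans, eqToHom_trans_assoc, eqToHom_refl, Category.comp_id, Category.id_comp]
  rw [this]

theorem mulAt_congr {x x' y y' : X ⟶ M.obj} (ex : x = x') (ey : y = y') :
    (f.mulAt x y).hom = eqToHom (by rw [ex, ey]) ≫ (f.mulAt x' y').hom ≫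
      eqToHom (by rw [ex, ey]) := by
  subst ex ey; simp

theorem whiskerLeft_mulAt (h : Y ⟶ X) {x y : X ⟶ M.obj} {x' y' : Y ⟶ M.obj}
    (ex : h ≫ x = x') (ey : h ≫ y = y') :
    h ◁ (f.mulAt x y).hom = eqToHom (by rw [← Strict.assoc, comp_ten, ex, ey]) ≫
      (f.mulAt x' y').hom ≫ eqToHom (by rw [comp_ten, ← ex, ← ey, Strict.assoc, Strict.assoc]) := by
  subst ex ey
  simp [mulAt, whiskerLeft_whiskerLeft (comp_pair h x y)]

theorem whiskerLeft_unitAt (h : Y ⟶ X) :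
    h ◁ (f.unitAt X).hom = eqToHom (by rw [← Strict.assoc, PsMonData.comp_unit]) ≫
      (f.unitAt Y).hom ≫ eqToHom (N.comp_unit h).symm := by
  simp [unitAt, whiskerLeft_whiskerLeft (comp_bang h)]

theorem mulAt_fst_snd :
    (f.mulAt (fst M.obj M.obj) (snd M.obj M.obj)).hom =
      eqToHom (by rw [ten, pair_eta, Strict.id_comp]) ≫ f.mulIso.hom := by
  simp only [mulAt, Iso.trans_hom, eqToIso.hom, whiskerLeftIso_hom,
    whiskerLeft_congr (pair_eta M.obj M.obj), id_whiskerLeft']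
  simp

/-- Compatibility of `φ₂` with the associativity constraints, at generalised elements. -/
def AssocAt (x y z : X ⟶ M.obj) : Prop :=
  (M.assocAt x y z).hom ▷ f.hom ≫ (f.mulAt x (ten M.mul y z)).hom ≫
      tenMap N.mul (𝟙 (x ≫ f.hom)) (f.mulAt y z).hom =
    (f.mulAt (ten M.mul x y) z).hom ≫ tenMap N.mul (f.mulAt x y).hom (𝟙 (z ≫ f.hom)) ≫
      (N.assocAt (x ≫ f.hom) (y ≫ f.hom) (z ≫ f.hom)).hom

/-- Compatibility of `φ₀` and `φ₂` with the left unit constraints, at a generalised element. -/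
def LeftAt (x : X ⟶ M.obj) : Prop :=
  (M.leftAt x).hom ▷ f.hom =
    (f.mulAt (bang X ≫ M.unit) x).hom ≫ tenMap N.mul (f.unitAt X).hom (𝟙 (x ≫ f.hom)) ≫
      (N.leftAt (x ≫ f.hom)).hom

/-- Compatibility of `φ₀` and `φ₂` with the right unit constraints, at a generalised element. -/
def RightAt (x : X ⟶ M.obj) : Prop :=
  (M.rightAt x).hom ▷ f.hom =
    (f.mulAt x (bang X ≫ M.unit)).hom ≫ tenMap N.mul (𝟙 (x ≫ f.hom)) (f.unitAt X).hom ≫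
      (N.rightAt (x ≫ f.hom)).hom

variable {f}

theorem AssocAt.whisker {x y z : X ⟶ M.obj} (H : f.AssocAt x y z) (h : Y ⟶ X) :
    f.AssocAt (h ≫ x) (h ≫ y) (h ≫ z) := by
  have := congrArg (h ◁ ·) H
  simp only [whiskerLeft_comp, whiskerLeft_whiskerRight, whiskerLeft_tenMap, whiskerLeft_id,
    M.whiskerLeft_assocAt h (rfl : h ≫ x = h ≫ x) (rfl : h ≫ y = h ≫ y) (rfl : h ≫ z = h ≫ z),
    N.whiskerLeft_assocAt h (Strict.assoc h x f.hom).symm (Strict.assoc h y f.hom).symm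
      (Strict.assoc h z f.hom).symm,
    f.whiskerLeft_mulAt h (rfl : h ≫ x = h ≫ x) (comp_ten M.mul h y z),
    f.whiskerLeft_mulAt h (rfl : h ≫ y = h ≫ y) (rfl : h ≫ z = h ≫ z),
    f.whiskerLeft_mulAt h (comp_ten M.mul h x y) (rfl : h ≫ z = h ≫ z),
    f.whiskerLeft_mulAt h (rfl : h ≫ x = h ≫ x) (rfl : h ≫ y = h ≫ y),
    id_conj (Strict.assoc h x f.hom).symm, id_conj (Strict.assoc h z f.hom).symm, tenMap_conj,
    comp_whiskerRight, eqToHom_whiskerRight] at this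
  simp only [Category.assoc, eqToHom_trans, eqToHom_trans_assoc, eqToHom_refl, Category.id_comp,
    Category.comp_id, cancel_epi] at this
  simp only [← Category.assoc, cancel_mono] at this
  simpa [AssocAt] using this

theorem LeftAt.whisker {x : X ⟶ M.obj} (H : f.LeftAt x) (h : Y ⟶ X) : f.LeftAt (h ≫ x) := by
  have := congrArg (h ◁ ·) H
  simp only [whiskerLeft_comp, whiskerLeft_whiskerRight, whiskerLeft_tenMap, whiskerLeft_id,
    M.whiskerLeft_leftAt h (rfl : h ≫ x = h ≫ x),
    N.whiskerLeft_leftAt h (Strict.assoc h x f.hom).symm,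
    f.whiskerLeft_mulAt h (M.comp_unit h) (rfl : h ≫ x = h ≫ x), f.whiskerLeft_unitAt h,
    id_conj (Strict.assoc h x f.hom).symm, tenMap_conj, comp_whiskerRight,
    eqToHom_whiskerRight] at this
  simp only [Category.assoc, eqToHom_trans, eqToHom_trans_assoc, eqToHom_refl, Category.id_comp,
    Category.comp_id, cancel_epi] at this
  simp only [← Category.assoc, cancel_mono] at this
  simpa [LeftAt] using this

theorem RightAt.whisker {x : X ⟶ M.obj} (H : f.RightAt x) (h : Y ⟶ X) : f.RightAt (h ≫ x) := by
  have := congrArg (h ◁ ·) H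
  simp only [whiskerLeft_comp, whiskerLeft_whiskerRight, whiskerLeft_tenMap, whiskerLeft_id,
    M.whiskerLeft_rightAt h (rfl : h ≫ x = h ≫ x),
    N.whiskerLeft_rightAt h (Strict.assoc h x f.hom).symm,
    f.whiskerLeft_mulAt h (rfl : h ≫ x = h ≫ x) (M.comp_unit h), f.whiskerLeft_unitAt h,
    id_conj (Strict.assoc h x f.hom).symm, tenMap_conj, comp_whiskerRight,
    eqToHom_whiskerRight] at this
  simp only [Category.assoc, eqToHom_trans, eqToHom_trans_assoc, eqToHom_refl, Category.id_comp,
    Category.comp_id, cancel_epi] at this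
  simp only [← Category.assoc, cancel_mono] at this
  simpa [RightAt] using this

end MonHomData

section

variable {K : Type u} [Bicategory.{w, v} K] [Bicategory.Strict K] [FiniteProducts K]

/-- A strong monoidal morphism of pseudo monoids. -/
structure MonHom (M N : PsMon K) extends MonHomData M.toPsMonData N.toPsMonData where
  assoc : toMonHomData.AssocAt (fst M.obj (prod M.obj M.obj))
    (snd M.obj (prod M.obj M.obj) ≫ fst M.obj M.obj)
    (snd M.obj (prod M.obj M.obj) ≫ snd M.obj M.obj)
  left : toMonHomData.LeftAt (𝟙 M.obj)
  right : toMonHomData.RightAt (𝟙 M.obj)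

/-- A monoidal `2`-cell between strong monoidal morphisms. -/
@[ext]
structure MonCell {M N : PsMon K} (f g : MonHom M N) where
  cell : f.hom ⟶ g.hom
  unit_cell : M.unit ◁ cell ≫ g.unitIso.hom = f.unitIso.hom
  mul_cell : M.mul ◁ cell ≫ g.mulIso.hom =
    f.mulIso.hom ≫ tenMap N.mul (fst M.obj M.obj ◁ cell) (snd M.obj M.obj ◁ cell)

namespace MonHom

variable {M N P : PsMon K} {X : K}

theorem assocAt (f : MonHom M N) (x y z : X ⟶ M.obj) : f.AssocAt x y z := by
  have := f.assoc.whisker (pair x (pair y z))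
  simpa only [pair_fst, pair_snd_comp, pair_snd] using this

theorem leftAt (f : MonHom M N) (x : X ⟶ M.obj) : f.LeftAt x := by
  have := f.left.whisker x
  simpa only [Strict.comp_id] using this

theorem rightAt (f : MonHom M N) (x : X ⟶ M.obj) : f.RightAt x := by
  have := f.right.whisker x
  simpa only [Strict.comp_id] using this

end MonHom

namespace MonHomData

variable {L M N P : PsMonData K} {X Y : K}

theorem id_mul_eq (M : PsMonData K) :
    M.mul ≫ 𝟙 M.obj = ten M.mul (fst M.obj M.obj ≫ 𝟙 M.obj) (snd M.obj M.obj ≫ 𝟙 M.obj) := by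
  simp only [Strict.comp_id]; rw [ten, pair_eta, Strict.id_comp]

/-- The identity morphism, with identity structure `2`-cells. -/
abbrev id (M : PsMonData K) : MonHomData M M where
  hom := 𝟙 M.obj
  unitIso := eqToIso (Strict.comp_id M.unit)
  mulIso := eqToIso (id_mul_eq M)

/-- Composition, with structure `2`-cells obtained by pasting. -/
abbrev comp (f : MonHomData M N) (g : MonHomData N P) : MonHomData M P where
  hom := f.hom ≫ g.hom
  unitIso := eqToIso (Strict.assoc _ _ _).symm ≪≫ whiskerRightIso f.unitIso g.hom ≪≫ g.unitIso
  mulIso := eqToIso (Strict.assoc _ _ _).symm ≪≫ whiskerRightIso f.mulIso g.hom ≪≫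
    g.mulAt (fst M.obj M.obj ≫ f.hom) (snd M.obj M.obj ≫ f.hom) ≪≫
      eqToIso (by simp only [Strict.assoc])

theorem id_hom (M : PsMonData K) : (id M).hom = 𝟙 M.obj := rfl

theorem comp_hom (f : MonHomData M N) (g : MonHomData N P) :
    (f.comp g).hom = f.hom ≫ g.hom := rfl

theorem id_unitIso_hom (M : PsMonData K) : (id M).unitIso.hom =
    eqToHom (by rw [id_hom, Strict.comp_id]) := rfl

theorem id_mulIso_hom (M : PsMonData K) : (id M).mulIso.hom =
    eqToHom (by rw [id_hom, id_mul_eq]) := rfl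

theorem comp_unitIso_hom (f : MonHomData M N) (g : MonHomData N P) : (f.comp g).unitIso.hom =
    eqToHom (by rw [comp_hom, Strict.assoc]) ≫ f.unitIso.hom ▷ g.hom ≫ g.unitIso.hom := rfl

theorem comp_mulIso_hom (f : MonHomData M N) (g : MonHomData N P) : (f.comp g).mulIso.hom =
    eqToHom (by rw [comp_hom, Strict.assoc]) ≫ f.mulIso.hom ▷ g.hom ≫
      (g.mulAt (fst M.obj M.obj ≫ f.hom) (snd M.obj M.obj ≫ f.hom)).hom ≫
        eqToHom (by simp only [comp_hom, Strict.assoc]) := rfl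

theorem unitAt_hom (f : MonHomData M N) (X : K) : (f.unitAt X).hom =
    eqToHom (Strict.assoc _ _ _) ≫ bang X ◁ f.unitIso.hom := rfl

theorem mulAt_hom (f : MonHomData M N) (x y : X ⟶ M.obj) : (f.mulAt x y).hom =
    eqToHom (ten_comp M.mul x y f.hom) ≫ pair x y ◁ f.mulIso.hom ≫
      eqToHom (f.comp_ten_hom x y) := rfl

theorem id_unitAt (M : PsMonData K) (X : K) :
    ((id M).unitAt X).hom = eqToHom (Strict.comp_id _) := by
  rw [unitAt_hom, id_unitIso_hom, whiskerLeft_eqToHom, eqToHom_trans]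

theorem id_mulAt (M : PsMonData K) (x y : X ⟶ M.obj) :
    ((id M).mulAt x y).hom = eqToHom (by simp only [id_hom, Strict.comp_id]) := by
  rw [mulAt_hom, id_mulIso_hom, whiskerLeft_eqToHom, eqToHom_trans, eqToHom_trans]

theorem comp_unitAt (f : MonHomData M N) (g : MonHomData N P) (X : K) :
    ((f.comp g).unitAt X).hom = eqToHom (by rw [comp_hom, ← Strict.assoc]) ≫
      ((f.unitAt X).hom ▷ g.hom ≫ (g.unitAt X).hom) ≫ eqToHom rfl := by
  rw [unitAt_hom, comp_unitIso_hom]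
  simp [unitAt_hom, Strict.associator_eqToIso]

theorem comp_mulAt (f : MonHomData M N) (g : MonHomData N P) (x y : X ⟶ M.obj) :
    ((f.comp g).mulAt x y).hom = eqToHom (by rw [comp_hom, Strict.assoc]) ≫
      ((f.mulAt x y).hom ▷ g.hom ≫ (g.mulAt (x ≫ f.hom) (y ≫ f.hom)).hom) ≫
        eqToHom (by simp only [comp_hom, Strict.assoc]) := by
  have e := g.whiskerLeft_mulAt (pair x y) (pair_fst_comp x y f.hom) (pair_snd_comp x y f.hom)
  rw [mulAt_hom, comp_mulIso_hom]
  simp only [whiskerLeft_comp, e]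
  simp [mulAt_hom, Strict.associator_eqToIso]

end MonHomData

namespace MonHomData

variable {L M N P : PsMonData K} {X Y : K}

theorem id_assocAt (M : PsMonData K) (x y z : X ⟶ M.obj) : (id M).AssocAt x y z := by
  simp only [AssocAt, id_mulAt, id_hom, M.assocAt_congr (Strict.comp_id x) (Strict.comp_id y)
    (Strict.comp_id z), whiskerRight_id', id_conj (Strict.comp_id x), id_conj (Strict.comp_id z)]
  simp

theorem id_leftAt (M : PsMonData K) (x : X ⟶ M.obj) : (id M).LeftAt x := by
  simp only [LeftAt, id_mulAt, id_unitAt, id_hom, M.leftAt_congr (Strict.comp_id x),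
    whiskerRight_id', id_conj (Strict.comp_id x)]
  simp

theorem id_rightAt (M : PsMonData K) (x : X ⟶ M.obj) : (id M).RightAt x := by
  simp only [RightAt, id_mulAt, id_unitAt, id_hom, M.rightAt_congr (Strict.comp_id x),
    whiskerRight_id', id_conj (Strict.comp_id x)]
  simp

theorem AssocAt.comp {f : MonHomData M N} {g : MonHomData N P} {x y z : X ⟶ M.obj}
    (hf : f.AssocAt x y z) (hg : g.AssocAt (x ≫ f.hom) (y ≫ f.hom) (z ≫ f.hom)) :
    (f.comp g).AssocAt x y z := by
  have hf' := congrArg (· ▷ g.hom) hf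
  have n₁ := g.mulAt_naturality (𝟙 (x ≫ f.hom)) (f.mulAt y z).hom
  have n₂ := g.mulAt_naturality (f.mulAt x y).hom (𝟙 (z ≫ f.hom))
  simp only [AssocAt, comp_whiskerRight, id_whiskerRight] at hf' hg n₁ n₂
  simp only [AssocAt, comp_mulAt, comp_hom,
    P.assocAt_congr (Strict.assoc x f.hom g.hom).symm (Strict.assoc y f.hom g.hom).symm
      (Strict.assoc z f.hom g.hom).symm, id_conj (Strict.assoc x f.hom g.hom).symm,
    id_conj (Strict.assoc z f.hom g.hom).symm, tenMap_conj, tenMap_comp_left, tenMap_comp_right]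
  rw [whiskerRight_comp']
  simp only [Category.assoc, eqToHom_trans_assoc, eqToHom_refl, Category.id_comp]
  rw [← reassoc_of% n₁, ← reassoc_of% n₂, reassoc_of% hf', reassoc_of% hg]

theorem LeftAt.comp {f : MonHomData M N} {g : MonHomData N P} {x : X ⟶ M.obj}
    (hf : f.LeftAt x) (hg : g.LeftAt (x ≫ f.hom)) : (f.comp g).LeftAt x := by
  have hf' := congrArg (· ▷ g.hom) hf
  have n₂ := g.mulAt_naturality (f.unitAt X).hom (𝟙 (x ≫ f.hom))
  simp only [LeftAt, comp_whiskerRight, id_whiskerRight] at hf' hg n₂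
  simp only [LeftAt, comp_mulAt, comp_unitAt, comp_hom,
    P.leftAt_congr (Strict.assoc x f.hom g.hom).symm, id_conj (Strict.assoc x f.hom g.hom).symm,
    tenMap_conj, tenMap_comp_left]
  rw [whiskerRight_comp']
  simp only [Category.assoc, eqToHom_trans_assoc, eqToHom_refl, Category.id_comp]
  rw [hf', hg, ← reassoc_of% n₂]
  simp only [Category.assoc]

theorem RightAt.comp {f : MonHomData M N} {g : MonHomData N P} {x : X ⟶ M.obj}
    (hf : f.RightAt x) (hg : g.RightAt (x ≫ f.hom)) : (f.comp g).RightAt x := by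
  have hf' := congrArg (· ▷ g.hom) hf
  have n₂ := g.mulAt_naturality (𝟙 (x ≫ f.hom)) (f.unitAt X).hom
  simp only [RightAt, comp_whiskerRight, id_whiskerRight] at hf' hg n₂
  simp only [RightAt, comp_mulAt, comp_unitAt, comp_hom,
    P.rightAt_congr (Strict.assoc x f.hom g.hom).symm, id_conj (Strict.assoc x f.hom g.hom).symm,
    tenMap_conj, tenMap_comp_right]
  rw [whiskerRight_comp']
  simp only [Category.assoc, eqToHom_trans_assoc, eqToHom_refl, Category.id_comp]
  rw [hf', hg, ← reassoc_of% n₂]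
  simp only [Category.assoc]

end MonHomData

namespace MonHom

variable {L M N P : PsMon K}

/-- The identity strong monoidal morphism. -/
abbrev id (M : PsMon K) : MonHom M M where
  toMonHomData := MonHomData.id M.toPsMonData
  assoc := MonHomData.id_assocAt _ _ _ _
  left := MonHomData.id_leftAt _ _
  right := MonHomData.id_rightAt _ _

/-- Composition of strong monoidal morphisms. -/
abbrev comp (f : MonHom M N) (g : MonHom N P) : MonHom M P where
  toMonHomData := f.toMonHomData.comp g.toMonHomData
  assoc := (f.assocAt _ _ _).comp (g.assocAt _ _ _)
  left := (f.leftAt _).comp (g.leftAt _)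
  right := (f.rightAt _).comp (g.rightAt _)

end MonHom

namespace MonCell

variable {L M N P : PsMon K}

/-- The identity `2`-cell. -/
def id (f : MonHom M N) : MonCell f f where
  cell := 𝟙 f.hom
  unit_cell := by simp
  mul_cell := by simp

/-- Vertical composition. -/
def comp {f g h : MonHom M N} (η : MonCell f g) (θ : MonCell g h) : MonCell f h where
  cell := η.cell ≫ θ.cell
  unit_cell := by rw [whiskerLeft_comp, Category.assoc, θ.unit_cell, η.unit_cell]
  mul_cell := by
    rw [whiskerLeft_comp, Category.assoc, θ.mul_cell, reassoc_of% η.mul_cell, whiskerLeft_comp,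
      whiskerLeft_comp, tenMap_comp]

instance (M N : PsMon K) : Category (MonHom M N) where
  Hom f g := MonCell f g
  id f := id f
  comp η θ := comp η θ
  id_comp η := MonCell.ext (Category.id_comp η.cell)
  comp_id η := MonCell.ext (Category.comp_id η.cell)
  assoc η θ κ := MonCell.ext (Category.assoc η.cell θ.cell κ.cell)

@[simp] theorem id_cell (f : MonHom M N) : (𝟙 f : MonCell f f).cell = 𝟙 f.hom := rfl

@[simp] theorem comp_cell {f g h : MonHom M N} (η : f ⟶ g) (θ : g ⟶ h) :
    (η ≫ θ : MonCell f h).cell = η.cell ≫ θ.cell := rfl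

@[ext]
theorem hom_ext {f g : MonHom M N} {η θ : f ⟶ g} (h : η.cell = θ.cell) : η = θ := MonCell.ext h

theorem eqToHom_cell {f g : MonHom M N} (e : f = g) :
    (eqToHom e).cell = eqToHom (congrArg (fun k => k.hom) e) := by
  subst e; rfl

theorem eq_of_cell {f g : MonHom M N} (η : f ⟶ g) (e : f.hom = g.hom)
    (h : η.cell = eqToHom e) : f = g := by
  obtain ⟨⟨f₁, f₂, f₃⟩, _, _, _⟩ := f
  obtain ⟨⟨g₁, g₂, g₃⟩, _, _, _⟩ := g
  obtain ⟨η, h₁, h₂⟩ := η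
  dsimp only at e h h₁ h₂ η
  subst e h
  have e₂ : f₂ = g₂ := by ext; simpa using h₁.symm
  have e₃ : f₃ = g₃ := by ext; simpa using h₂.symm
  subst e₂ e₃
  rfl

/-- An invertible `2`-cell that is monoidal has a monoidal inverse. -/
def mkIso {f g : MonHom M N} (η : f.hom ≅ g.hom)
    (h₁ : M.unit ◁ η.hom ≫ g.unitIso.hom = f.unitIso.hom)
    (h₂ : M.mul ◁ η.hom ≫ g.mulIso.hom =
      f.mulIso.hom ≫ tenMap N.mul (fst M.obj M.obj ◁ η.hom) (snd M.obj M.obj ◁ η.hom)) :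
    f ≅ g where
  hom := ⟨η.hom, h₁, h₂⟩
  inv := ⟨η.inv, by rw [← h₁]; simp, by
    have : tenMap N.mul (fst M.obj M.obj ◁ η.hom) (snd M.obj M.obj ◁ η.hom) ≫
      tenMap N.mul (fst M.obj M.obj ◁ η.inv) (snd M.obj M.obj ◁ η.inv) = 𝟙 _ := by
        simp [← tenMap_comp]
    rw [← cancel_epi (M.mul ◁ η.hom), reassoc_of% h₂, this]
    simp⟩
  hom_inv_id := hom_ext η.hom_inv_id
  inv_hom_id := hom_ext η.inv_hom_id

theorem mulAt_cell {f g : MonHom M N} (η : f ⟶ g) {X : K} (x y : X ⟶ M.obj) :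
    ten M.mul x y ◁ η.cell ≫ (g.mulAt x y).hom =
      (f.mulAt x y).hom ≫ tenMap N.mul (x ◁ η.cell) (y ◁ η.cell) := by
  have := congrArg (pair x y ◁ ·) η.mul_cell
  simp only [whiskerLeft_comp, whiskerLeft_tenMap, whiskerLeft_whiskerLeft (pair_fst x y),
    whiskerLeft_whiskerLeft (pair_snd x y), tenMap_conj,
    whiskerLeft_whiskerLeft (show pair x y ≫ M.mul = ten M.mul x y from rfl)] at this
  simp only [MonHomData.mulAt_hom]
  rw [← cancel_epi (eqToHom (ten_comp M.mul x y f.hom).symm),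
    ← cancel_mono (eqToHom (g.comp_ten_hom x y).symm)]
  simpa using this

/-- Left whiskering. -/
def whiskerLeft (f : MonHom L M) {g h : MonHom M N} (η : MonCell g h) :
    MonCell (f.comp g) (f.comp h) where
  cell := f.hom ◁ η.cell
  unit_cell := by
    have := whisker_exchange f.unitIso.hom η.cell
    have e := η.unit_cell
    simp only [Iso.trans_hom, eqToIso.hom, whiskerRightIso_hom]
    rw [← e, ← reassoc_of% this]
    simp [Strict.associator_eqToIso]
  mul_cell := by
    have e := mulAt_cell η (fst L.obj L.obj ≫ f.hom) (snd L.obj L.obj ≫ f.hom)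
    have := whisker_exchange f.mulIso.hom η.cell
    simp only [comp_whiskerLeft' _ _ η.cell, tenMap_conj, Category.assoc] at e this
    simp only [Iso.trans_hom, eqToIso.hom, whiskerRightIso_hom, Category.assoc]
    rw [← cancel_epi (eqToHom (Strict.assoc _ _ _)), reassoc_of% this, reassoc_of% e]
    simp

/-- Right whiskering. -/
def whiskerRight {f g : MonHom L M} (η : MonCell f g) (h : MonHom M N) :
    MonCell (f.comp h) (g.comp h) where
  cell := η.cell ▷ h.hom
  unit_cell := by
    have e := congrArg (· ▷ h.hom) η.unit_cell
    simp only [Iso.trans_hom, eqToIso.hom, whiskerRightIso_hom]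
    rw [← e]
    simp [Strict.associator_eqToIso]
  mul_cell := by
    have e := congrArg (· ▷ h.hom) η.mul_cell
    have n := h.mulAt_naturality (fst L.obj L.obj ◁ η.cell) (snd L.obj L.obj ◁ η.cell)
    simp only [comp_whiskerRight, whisker_assoc' _ η.cell, tenMap_conj, Category.assoc] at e n
    simp only [Iso.trans_hom, eqToIso.hom, whiskerRightIso_hom, Category.assoc]
    rw [← cancel_epi (eqToHom (Strict.assoc _ _ _))]
    simp only [eqToHom_trans_assoc, eqToHom_refl, Category.id_comp]
    rw [reassoc_of% e, reassoc_of% n]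
    simp

/-- The associator, an identity `2`-cell. -/
def associator (f : MonHom L M) (g : MonHom M N) (h : MonHom N P) :
    (f.comp g).comp h ≅ f.comp (g.comp h) :=
  mkIso (α_ f.hom g.hom h.hom)
    (by
      simp [Strict.associator_eqToIso])
    (by
      simp only [MonHomData.comp_mulAt, Iso.trans_hom, eqToIso.hom, whiskerRightIso_hom]
      rw [h.mulAt_congr (Strict.assoc (fst L.obj L.obj) f.hom g.hom).symm
        (Strict.assoc (snd L.obj L.obj) f.hom g.hom).symm]
      simp [Strict.associator_eqToIso])

/-- The left unitor, an identity `2`-cell. -/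
def leftUnitor (f : MonHom M N) : (MonHom.id M).comp f ≅ f :=
  mkIso (λ_ f.hom)
    (by
      simp [Strict.leftUnitor_eqToIso])
    (by
      simp only [Iso.trans_hom, eqToIso.hom, whiskerRightIso_hom]
      rw [f.mulAt_congr (Strict.comp_id (fst M.obj M.obj)) (Strict.comp_id (snd M.obj M.obj)),
        f.mulAt_fst_snd]
      simp [Strict.leftUnitor_eqToIso])

/-- The right unitor, an identity `2`-cell. -/
def rightUnitor (f : MonHom M N) : f.comp (MonHom.id N) ≅ f :=
  mkIso (ρ_ f.hom)
    (by
      simp [Strict.rightUnitor_eqToIso])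
    (by
      simp only [MonHomData.id_mulAt, Iso.trans_hom, eqToIso.hom, whiskerRightIso_hom]
      simp [Strict.rightUnitor_eqToIso])

end MonCell

/-- The `2`-category of pseudo monoids, strong monoidal morphisms and monoidal `2`-cells. -/
instance : Bicategory (PsMon K) where
  Hom M N := MonHom M N
  id M := MonHom.id M
  comp f g := MonHom.comp f g
  homCategory M N := inferInstanceAs (Category (MonHom M N))
  whiskerLeft f _ _ η := MonCell.whiskerLeft f η
  whiskerRight η h := MonCell.whiskerRight η h
  associator f g h := MonCell.associator f g h
  leftUnitor f := MonCell.leftUnitor f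
  rightUnitor f := MonCell.rightUnitor f
  whiskerLeft_id f g := MonCell.hom_ext (Bicategory.whiskerLeft_id f.hom g.hom)
  whiskerLeft_comp f _ _ _ η θ := MonCell.hom_ext (Bicategory.whiskerLeft_comp f.hom η.cell θ.cell)
  id_whiskerLeft η := MonCell.hom_ext (Bicategory.id_whiskerLeft η.cell)
  comp_whiskerLeft f g _ _ η := MonCell.hom_ext (Bicategory.comp_whiskerLeft f.hom g.hom η.cell)
  id_whiskerRight f g := MonCell.hom_ext (Bicategory.id_whiskerRight f.hom g.hom)
  comp_whiskerRight η θ h := MonCell.hom_ext (Bicategory.comp_whiskerRight η.cell θ.cell h.hom)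
  whiskerRight_id η := MonCell.hom_ext (Bicategory.whiskerRight_id η.cell)
  whiskerRight_comp η g h := MonCell.hom_ext (Bicategory.whiskerRight_comp η.cell g.hom h.hom)
  whisker_assoc f _ _ η h := MonCell.hom_ext (Bicategory.whisker_assoc f.hom η.cell h.hom)
  whisker_exchange η θ := MonCell.hom_ext (Bicategory.whisker_exchange η.cell θ.cell)
  pentagon f g h i := MonCell.hom_ext (Bicategory.pentagon f.hom g.hom h.hom i.hom)
  triangle f g := MonCell.hom_ext (Bicategory.triangle f.hom g.hom)

namespace PsMon

variable {L M N P : PsMon K}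

theorem id_hom (M : PsMon K) : (𝟙 M : MonHom M M).hom = 𝟙 M.obj := rfl

theorem comp_hom (f : L ⟶ M) (g : M ⟶ N) : (f ≫ g : MonHom L N).hom = f.hom ≫ g.hom := rfl

theorem id_cell (f : L ⟶ M) : (𝟙 f : MonCell f f).cell = 𝟙 f.hom := rfl

theorem comp_cell {f g h : L ⟶ M} (η : f ⟶ g) (θ : g ⟶ h) :
    (η ≫ θ : MonCell f h).cell = η.cell ≫ θ.cell := rfl

theorem whiskerLeft_cell (f : L ⟶ M) {g h : M ⟶ N} (η : g ⟶ h) :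
    (f ◁ η : MonCell (f ≫ g) (f ≫ h)).cell = f.hom ◁ η.cell := rfl

theorem whiskerRight_cell {f g : L ⟶ M} (η : f ⟶ g) (h : M ⟶ N) :
    (η ▷ h : MonCell (f ≫ h) (g ≫ h)).cell = η.cell ▷ h.hom := rfl

theorem hom_eq_of_cell {f g : L ⟶ M} (η : f ⟶ g) (e : f.hom = g.hom)
    (h : η.cell = eqToHom e) : f = g := MonCell.eq_of_cell η e h

theorem eqToHom_cell {f g : L ⟶ M} (e : f = g) :
    (eqToHom e : f ⟶ g).cell = eqToHom (congrArg (fun k => k.hom) e) := by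
  subst e; rfl

theorem cell_ext {f g : L ⟶ M} {η θ : f ⟶ g} (h : η.cell = θ.cell) : η = θ := MonCell.ext h

end PsMon

instance : Bicategory.Strict (PsMon K) where
  id_comp f := PsMon.hom_eq_of_cell (λ_ f).hom (Strict.id_comp f.hom)
    (congrArg Iso.hom (Strict.leftUnitor_eqToIso f.hom))
  comp_id f := PsMon.hom_eq_of_cell (ρ_ f).hom (Strict.comp_id f.hom)
    (congrArg Iso.hom (Strict.rightUnitor_eqToIso f.hom))
  assoc f g h := PsMon.hom_eq_of_cell (α_ f g h).hom (Strict.assoc f.hom g.hom h.hom)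
    (congrArg Iso.hom (Strict.associator_eqToIso f.hom g.hom h.hom))
  leftUnitor_eqToIso f := by
    ext
    refine PsMon.cell_ext ?_
    rw [eqToIso.hom, PsMon.eqToHom_cell]
    exact congrArg Iso.hom (Strict.leftUnitor_eqToIso f.hom)
  rightUnitor_eqToIso f := by
    ext
    refine PsMon.cell_ext ?_
    rw [eqToIso.hom, PsMon.eqToHom_cell]
    exact congrArg Iso.hom (Strict.rightUnitor_eqToIso f.hom)
  associator_eqToIso f g h := by
    ext
    refine PsMon.cell_ext ?_
    rw [eqToIso.hom, PsMon.eqToHom_cell]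
    exact congrArg Iso.hom (Strict.associator_eqToIso f.hom g.hom h.hom)

end

section

variable {K : Type u} [Bicategory.{w, v} K] [FiniteProducts K]

/-- The invertible `2`-cell between `1`-cells into a product with given components. -/
@[simps]
def lift₂Iso {X A B : K} {h k : X ⟶ prod A B} (η : h ≫ fst A B ≅ k ≫ fst A B)
    (θ : h ≫ snd A B ≅ k ≫ snd A B) : h ≅ k where
  hom := lift₂ η.hom θ.hom
  inv := lift₂ η.inv θ.inv
  hom_inv_id := hom_ext₂ (by simp) (by simp)
  inv_hom_id := hom_ext₂ (by simp) (by simp)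

variable [Bicategory.Strict K]

namespace PsMonData

variable (M N : PsMonData K) {X : K}

/-- The componentwise multiplication on a product. -/
def prodMul : prod (prod M.obj N.obj) (prod M.obj N.obj) ⟶ prod M.obj N.obj :=
  pair
    (ten M.mul (fst (prod M.obj N.obj) (prod M.obj N.obj) ≫ fst M.obj N.obj)
      (snd (prod M.obj N.obj) (prod M.obj N.obj) ≫ fst M.obj N.obj))
    (ten N.mul (fst (prod M.obj N.obj) (prod M.obj N.obj) ≫ snd M.obj N.obj)
      (snd (prod M.obj N.obj) (prod M.obj N.obj) ≫ snd M.obj N.obj))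

theorem prodMul_fst : prodMul M N ≫ fst M.obj N.obj =
    ten M.mul (fst (prod M.obj N.obj) (prod M.obj N.obj) ≫ fst M.obj N.obj)
      (snd (prod M.obj N.obj) (prod M.obj N.obj) ≫ fst M.obj N.obj) :=
  pair_fst _ _

theorem prodMul_snd : prodMul M N ≫ snd M.obj N.obj =
    ten N.mul (fst (prod M.obj N.obj) (prod M.obj N.obj) ≫ snd M.obj N.obj)
      (snd (prod M.obj N.obj) (prod M.obj N.obj) ≫ snd M.obj N.obj) :=
  pair_snd _ _

variable {M N}

theorem ten_prodMul_fst (x y : X ⟶ prod M.obj N.obj) :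
    ten (prodMul M N) x y ≫ fst M.obj N.obj =
      ten M.mul (x ≫ fst M.obj N.obj) (y ≫ fst M.obj N.obj) := by
  rw [ten_comp, prodMul_fst, comp_ten, pair_fst_comp, pair_snd_comp]

theorem ten_prodMul_snd (x y : X ⟶ prod M.obj N.obj) :
    ten (prodMul M N) x y ≫ snd M.obj N.obj =
      ten N.mul (x ≫ snd M.obj N.obj) (y ≫ snd M.obj N.obj) := by
  rw [ten_comp, prodMul_snd, comp_ten, pair_fst_comp, pair_snd_comp]

theorem tenMap_prodMul_fst {x x' y y' : X ⟶ prod M.obj N.obj} (η : x ⟶ x') (θ : y ⟶ y') :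
    tenMap (prodMul M N) η θ ▷ fst M.obj N.obj = eqToHom (ten_prodMul_fst x y) ≫
      tenMap M.mul (η ▷ fst M.obj N.obj) (θ ▷ fst M.obj N.obj) ≫
        eqToHom (ten_prodMul_fst x' y').symm := by
  rw [tenMap_whiskerRight, whiskerRight_congr (prodMul_fst M N), whiskerRight_ten,
    pairMap_whiskerRight_fst_comp, pairMap_whiskerRight_snd_comp, tenMap_conj]
  simp

theorem tenMap_prodMul_snd {x x' y y' : X ⟶ prod M.obj N.obj} (η : x ⟶ x') (θ : y ⟶ y') :
    tenMap (prodMul M N) η θ ▷ snd M.obj N.obj = eqToHom (ten_prodMul_snd x y) ≫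
      tenMap N.mul (η ▷ snd M.obj N.obj) (θ ▷ snd M.obj N.obj) ≫
        eqToHom (ten_prodMul_snd x' y').symm := by
  rw [tenMap_whiskerRight, whiskerRight_congr (prodMul_snd M N), whiskerRight_ten,
    pairMap_whiskerRight_fst_comp, pairMap_whiskerRight_snd_comp, tenMap_conj]
  simp

variable (M N)

theorem prodUnit_fst : (bang X ≫ pair M.unit N.unit) ≫ fst M.obj N.obj = bang X ≫ M.unit := by
  rw [Strict.assoc, pair_fst]

theorem prodUnit_snd : (bang X ≫ pair M.unit N.unit) ≫ snd M.obj N.obj = bang X ≫ N.unit := by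
  rw [Strict.assoc, pair_snd]

/-- The product pseudo monoid, with componentwise structure. -/
abbrev prodData : PsMonData K where
  obj := prod M.obj N.obj
  unit := pair M.unit N.unit
  mul := prodMul M N
  assoc := lift₂Iso
    (eqToIso (by rw [ten_prodMul_fst, ten_prodMul_fst]) ≪≫
      M.assocAt
        (fst (prod M.obj N.obj) (prod (prod M.obj N.obj) (prod M.obj N.obj)) ≫ fst M.obj N.obj)
        ((snd (prod M.obj N.obj) (prod (prod M.obj N.obj) (prod M.obj N.obj)) ≫
          fst (prod M.obj N.obj) (prod M.obj N.obj)) ≫ fst M.obj N.obj)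
        ((snd (prod M.obj N.obj) (prod (prod M.obj N.obj) (prod M.obj N.obj)) ≫
          snd (prod M.obj N.obj) (prod M.obj N.obj)) ≫ fst M.obj N.obj) ≪≫
      eqToIso (by rw [ten_prodMul_fst, ten_prodMul_fst]))
    (eqToIso (by rw [ten_prodMul_snd, ten_prodMul_snd]) ≪≫
      N.assocAt
        (fst (prod M.obj N.obj) (prod (prod M.obj N.obj) (prod M.obj N.obj)) ≫ snd M.obj N.obj)
        ((snd (prod M.obj N.obj) (prod (prod M.obj N.obj) (prod M.obj N.obj)) ≫
          fst (prod M.obj N.obj) (prod M.obj N.obj)) ≫ snd M.obj N.obj)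
        ((snd (prod M.obj N.obj) (prod (prod M.obj N.obj) (prod M.obj N.obj)) ≫
          snd (prod M.obj N.obj) (prod M.obj N.obj)) ≫ snd M.obj N.obj) ≪≫
      eqToIso (by rw [ten_prodMul_snd, ten_prodMul_snd]))
  leftUnit := lift₂Iso
    (eqToIso (by rw [ten_prodMul_fst, prodUnit_fst, Strict.id_comp]) ≪≫
      M.leftAt (fst M.obj N.obj) ≪≫ eqToIso (Strict.id_comp _).symm)
    (eqToIso (by rw [ten_prodMul_snd, prodUnit_snd, Strict.id_comp]) ≪≫
      N.leftAt (snd M.obj N.obj) ≪≫ eqToIso (Strict.id_comp _).symm)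
  rightUnit := lift₂Iso
    (eqToIso (by rw [ten_prodMul_fst, prodUnit_fst, Strict.id_comp]) ≪≫
      M.rightAt (fst M.obj N.obj) ≪≫ eqToIso (Strict.id_comp _).symm)
    (eqToIso (by rw [ten_prodMul_snd, prodUnit_snd, Strict.id_comp]) ≪≫
      N.rightAt (snd M.obj N.obj) ≪≫ eqToIso (Strict.id_comp _).symm)

theorem prod_assocAt_fst (x y z : X ⟶ prod M.obj N.obj) :
    ((prodData M N).assocAt x y z).hom ▷ fst M.obj N.obj =
      eqToHom (by rw [ten_prodMul_fst, ten_prodMul_fst]) ≫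
        (M.assocAt (x ≫ fst M.obj N.obj) (y ≫ fst M.obj N.obj) (z ≫ fst M.obj N.obj)).hom ≫
          eqToHom (by rw [ten_prodMul_fst, ten_prodMul_fst]) := by
  have e := M.whiskerLeft_assocAt (pair x (pair y z))
    (pair_fst_comp x (pair y z) (fst M.obj N.obj))
    (show pair x (pair y z) ≫ (snd (prod M.obj N.obj) _ ≫ fst _ _) ≫ fst _ _ = y ≫ fst _ _ by
      rw [← Strict.assoc, pair_snd_comp, pair_fst])
    (show pair x (pair y z) ≫ (snd (prod M.obj N.obj) _ ≫ snd _ _) ≫ fst _ _ = z ≫ fst _ _ by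
      rw [← Strict.assoc, pair_snd_comp, pair_snd])
  rw [assocAt]
  simp only [Iso.trans_hom, eqToIso.hom, whiskerLeftIso_hom, comp_whiskerRight,
    eqToHom_whiskerRight, whisker_assoc', lift₂Iso_hom, lift₂_fst, whiskerLeft_comp,
    whiskerLeft_eqToHom, e]
  simp

theorem prod_assocAt_snd (x y z : X ⟶ prod M.obj N.obj) :
    ((prodData M N).assocAt x y z).hom ▷ snd M.obj N.obj =
      eqToHom (by rw [ten_prodMul_snd, ten_prodMul_snd]) ≫
        (N.assocAt (x ≫ snd M.obj N.obj) (y ≫ snd M.obj N.obj) (z ≫ snd M.obj N.obj)).hom ≫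
          eqToHom (by rw [ten_prodMul_snd, ten_prodMul_snd]) := by
  have e := N.whiskerLeft_assocAt (pair x (pair y z))
    (pair_fst_comp x (pair y z) (snd M.obj N.obj))
    (show pair x (pair y z) ≫ (snd (prod M.obj N.obj) _ ≫ fst _ _) ≫ snd _ _ = y ≫ snd _ _ by
      rw [← Strict.assoc, pair_snd_comp, pair_fst])
    (show pair x (pair y z) ≫ (snd (prod M.obj N.obj) _ ≫ snd _ _) ≫ snd _ _ = z ≫ snd _ _ by
      rw [← Strict.assoc, pair_snd_comp, pair_snd])
  rw [assocAt]
  simp only [Iso.trans_hom, eqToIso.hom, whiskerLeftIso_hom, comp_whiskerRight,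
    eqToHom_whiskerRight, whisker_assoc', lift₂Iso_hom, lift₂_snd, whiskerLeft_comp,
    whiskerLeft_eqToHom, e]
  simp

theorem prod_leftAt_fst (x : X ⟶ prod M.obj N.obj) :
    ((prodData M N).leftAt x).hom ▷ fst M.obj N.obj =
      eqToHom (by rw [ten_prodMul_fst, prodUnit_fst]) ≫ (M.leftAt (x ≫ fst M.obj N.obj)).hom ≫
        eqToHom rfl := by
  have e := M.whiskerLeft_leftAt x (rfl : x ≫ fst M.obj N.obj = _)
  rw [leftAt]
  simp only [Iso.trans_hom, eqToIso.hom, whiskerLeftIso_hom, comp_whiskerRight,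
    eqToHom_whiskerRight, whisker_assoc', lift₂Iso_hom, lift₂_fst, whiskerLeft_comp,
    whiskerLeft_eqToHom, e]
  simp

theorem prod_leftAt_snd (x : X ⟶ prod M.obj N.obj) :
    ((prodData M N).leftAt x).hom ▷ snd M.obj N.obj =
      eqToHom (by rw [ten_prodMul_snd, prodUnit_snd]) ≫ (N.leftAt (x ≫ snd M.obj N.obj)).hom ≫
        eqToHom rfl := by
  have e := N.whiskerLeft_leftAt x (rfl : x ≫ snd M.obj N.obj = _)
  rw [leftAt]
  simp only [Iso.trans_hom, eqToIso.hom, whiskerLeftIso_hom, comp_whiskerRight,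
    eqToHom_whiskerRight, whisker_assoc', lift₂Iso_hom, lift₂_snd, whiskerLeft_comp,
    whiskerLeft_eqToHom, e]
  simp

theorem prod_rightAt_fst (x : X ⟶ prod M.obj N.obj) :
    ((prodData M N).rightAt x).hom ▷ fst M.obj N.obj =
      eqToHom (by rw [ten_prodMul_fst, prodUnit_fst]) ≫ (M.rightAt (x ≫ fst M.obj N.obj)).hom ≫
        eqToHom rfl := by
  have e := M.whiskerLeft_rightAt x (rfl : x ≫ fst M.obj N.obj = _)
  rw [rightAt]
  simp only [Iso.trans_hom, eqToIso.hom, whiskerLeftIso_hom, comp_whiskerRight,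
    eqToHom_whiskerRight, whisker_assoc', lift₂Iso_hom, lift₂_fst, whiskerLeft_comp,
    whiskerLeft_eqToHom, e]
  simp

theorem prod_rightAt_snd (x : X ⟶ prod M.obj N.obj) :
    ((prodData M N).rightAt x).hom ▷ snd M.obj N.obj =
      eqToHom (by rw [ten_prodMul_snd, prodUnit_snd]) ≫ (N.rightAt (x ≫ snd M.obj N.obj)).hom ≫
        eqToHom rfl := by
  have e := N.whiskerLeft_rightAt x (rfl : x ≫ snd M.obj N.obj = _)
  rw [rightAt]
  simp only [Iso.trans_hom, eqToIso.hom, whiskerLeftIso_hom, comp_whiskerRight,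
    eqToHom_whiskerRight, whisker_assoc', lift₂Iso_hom, lift₂_snd, whiskerLeft_comp,
    whiskerLeft_eqToHom, e]
  simp

variable {M N}

theorem PentagonAt.prod {w x y z : X ⟶ prod M.obj N.obj}
    (h₁ : M.PentagonAt (w ≫ fst M.obj N.obj) (x ≫ fst M.obj N.obj) (y ≫ fst M.obj N.obj)
      (z ≫ fst M.obj N.obj))
    (h₂ : N.PentagonAt (w ≫ snd M.obj N.obj) (x ≫ snd M.obj N.obj) (y ≫ snd M.obj N.obj)
      (z ≫ snd M.obj N.obj)) :
    (prodData M N).PentagonAt w x y z := by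
  unfold PentagonAt at *
  refine hom_ext₂ ?_ ?_
  · simp only [comp_whiskerRight, prod_assocAt_fst, tenMap_prodMul_fst, id_whiskerRight,
      tenMap_conj_left, tenMap_conj_right]
    simp only [M.assocAt_congr rfl (ten_prodMul_fst x y) rfl,
      M.assocAt_congr (ten_prodMul_fst w x) rfl rfl, M.assocAt_congr rfl rfl (ten_prodMul_fst y z)]
    simp only [Category.assoc, eqToHom_trans, eqToHom_trans_assoc, eqToHom_refl, Category.id_comp]
    rw [← reassoc_of% h₁]
  · simp only [comp_whiskerRight, prod_assocAt_snd, tenMap_prodMul_snd, id_whiskerRight,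
      tenMap_conj_left, tenMap_conj_right]
    simp only [N.assocAt_congr rfl (ten_prodMul_snd x y) rfl,
      N.assocAt_congr (ten_prodMul_snd w x) rfl rfl, N.assocAt_congr rfl rfl (ten_prodMul_snd y z)]
    simp only [Category.assoc, eqToHom_trans, eqToHom_trans_assoc, eqToHom_refl, Category.id_comp]
    rw [← reassoc_of% h₂]

theorem TriangleAt.prod {x y : X ⟶ prod M.obj N.obj}
    (h₁ : M.TriangleAt (x ≫ fst M.obj N.obj) (y ≫ fst M.obj N.obj))
    (h₂ : N.TriangleAt (x ≫ snd M.obj N.obj) (y ≫ snd M.obj N.obj)) :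
    (prodData M N).TriangleAt x y := by
  unfold TriangleAt at *
  refine hom_ext₂ ?_ ?_
  · simp only [comp_whiskerRight, prod_assocAt_fst, prod_leftAt_fst, prod_rightAt_fst,
      tenMap_prodMul_fst, id_whiskerRight, tenMap_conj_left, tenMap_conj_right,
      M.assocAt_congr rfl (prodUnit_fst M N) rfl]
    simp only [Category.assoc, eqToHom_trans, eqToHom_trans_assoc, eqToHom_refl, Category.id_comp]
    rw [← reassoc_of% h₁]
  · simp only [comp_whiskerRight, prod_assocAt_snd, prod_leftAt_snd, prod_rightAt_snd,
      tenMap_prodMul_snd, id_whiskerRight, tenMap_conj_left, tenMap_conj_right,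
      N.assocAt_congr rfl (prodUnit_snd M N) rfl]
    simp only [Category.assoc, eqToHom_trans, eqToHom_trans_assoc, eqToHom_refl, Category.id_comp]
    rw [← reassoc_of% h₂]

end PsMonData

namespace PsMon

/-- The product of two pseudo monoids. -/
abbrev prod (M N : PsMon K) : PsMon K where
  toPsMonData := PsMonData.prodData M.toPsMonData N.toPsMonData
  pentagon := PsMonData.PentagonAt.prod (M.pentagonAt _ _ _ _) (N.pentagonAt _ _ _ _)
  triangle := PsMonData.TriangleAt.prod (M.triangleAt _ _) (N.triangleAt _ _)

/-- The terminal pseudo monoid. -/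
abbrev one : PsMon K where
  obj := FiniteProducts.one
  unit := 𝟙 _
  mul := bang _
  assoc := eqToIso ((bang_uniq _).trans (bang_uniq _).symm)
  leftUnit := eqToIso ((bang_uniq _).trans (bang_uniq _).symm)
  rightUnit := eqToIso ((bang_uniq _).trans (bang_uniq _).symm)
  pentagon := bang_ext₂ _ _
  triangle := bang_ext₂ _ _

/-- The unique morphism to the terminal pseudo monoid. -/
abbrev bang (M : PsMon K) : MonHom M (one : PsMon K) where
  hom := FiniteProducts.bang M.obj
  unitIso := eqToIso ((bang_uniq _).trans (bang_uniq _).symm)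
  mulIso := eqToIso ((bang_uniq _).trans (bang_uniq _).symm)
  assoc := bang_ext₂ _ _
  left := bang_ext₂ _ _
  right := bang_ext₂ _ _

variable (M N : PsMon K) {X : K}

/-- The first projection with identity structure `2`-cells. -/
abbrev fstData : MonHomData (prod M N).toPsMonData M.toPsMonData where
  hom := FiniteProducts.fst M.obj N.obj
  unitIso := eqToIso (pair_fst _ _)
  mulIso := eqToIso (PsMonData.prodMul_fst _ _)

/-- The second projection with identity structure `2`-cells. -/
abbrev sndData : MonHomData (prod M N).toPsMonData N.toPsMonData where
  hom := FiniteProducts.snd M.obj N.obj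
  unitIso := eqToIso (pair_snd _ _)
  mulIso := eqToIso (PsMonData.prodMul_snd _ _)

theorem fst_mulAt (x y : X ⟶ FiniteProducts.prod M.obj N.obj) :
    ((fstData M N).mulAt x y).hom = eqToHom (PsMonData.ten_prodMul_fst x y) := by
  simp only [MonHomData.mulAt_hom, eqToIso.hom, whiskerLeft_eqToHom, eqToHom_trans]

theorem snd_mulAt (x y : X ⟶ FiniteProducts.prod M.obj N.obj) :
    ((sndData M N).mulAt x y).hom = eqToHom (PsMonData.ten_prodMul_snd x y) := by
  simp only [MonHomData.mulAt_hom, eqToIso.hom, whiskerLeft_eqToHom, eqToHom_trans]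

theorem fst_unitAt :
    ((fstData M N).unitAt X).hom = eqToHom (PsMonData.prodUnit_fst _ _) := by
  simp only [MonHomData.unitAt_hom, eqToIso.hom, whiskerLeft_eqToHom, eqToHom_trans]

theorem snd_unitAt :
    ((sndData M N).unitAt X).hom = eqToHom (PsMonData.prodUnit_snd _ _) := by
  simp only [MonHomData.unitAt_hom, eqToIso.hom, whiskerLeft_eqToHom, eqToHom_trans]

theorem fst_assocAt (x y z : X ⟶ FiniteProducts.prod M.obj N.obj) :
    (fstData M N).AssocAt x y z := by
  simp only [MonHomData.AssocAt, fst_mulAt, PsMonData.prod_assocAt_fst]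
  simp

theorem snd_assocAt (x y z : X ⟶ FiniteProducts.prod M.obj N.obj) :
    (sndData M N).AssocAt x y z := by
  simp only [MonHomData.AssocAt, snd_mulAt, PsMonData.prod_assocAt_snd]
  simp

theorem fst_leftAt (x : X ⟶ FiniteProducts.prod M.obj N.obj) : (fstData M N).LeftAt x := by
  simp only [MonHomData.LeftAt, fst_mulAt, fst_unitAt, PsMonData.prod_leftAt_fst]
  simp

theorem snd_leftAt (x : X ⟶ FiniteProducts.prod M.obj N.obj) : (sndData M N).LeftAt x := by
  simp only [MonHomData.LeftAt, snd_mulAt, snd_unitAt, PsMonData.prod_leftAt_snd]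
  simp

theorem fst_rightAt (x : X ⟶ FiniteProducts.prod M.obj N.obj) : (fstData M N).RightAt x := by
  simp only [MonHomData.RightAt, fst_mulAt, fst_unitAt, PsMonData.prod_rightAt_fst]
  simp

theorem snd_rightAt (x : X ⟶ FiniteProducts.prod M.obj N.obj) : (sndData M N).RightAt x := by
  simp only [MonHomData.RightAt, snd_mulAt, snd_unitAt, PsMonData.prod_rightAt_snd]
  simp

/-- The first projection, strictly monoidal. -/
abbrev fst : MonHom (prod M N) M where
  toMonHomData := fstData M N
  assoc := fst_assocAt M N _ _ _
  left := fst_leftAt M N _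
  right := fst_rightAt M N _

/-- The second projection, strictly monoidal. -/
abbrev snd : MonHom (prod M N) N where
  toMonHomData := sndData M N
  assoc := snd_assocAt M N _ _ _
  left := snd_leftAt M N _
  right := snd_rightAt M N _

variable {M N} {L : PsMon K} (f : MonHom L M) (g : MonHom L N)

theorem comp_pair_fst_eq (x : X ⟶ L.obj) :
    (x ≫ FiniteProducts.pair f.hom g.hom) ≫ FiniteProducts.fst M.obj N.obj = x ≫ f.hom := by
  rw [Strict.assoc, pair_fst]

theorem comp_pair_snd_eq (x : X ⟶ L.obj) :
    (x ≫ FiniteProducts.pair f.hom g.hom) ≫ FiniteProducts.snd M.obj N.obj = x ≫ g.hom := by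
  rw [Strict.assoc, pair_snd]

/-- The pairing of two strong monoidal morphisms. -/
abbrev pairData : MonHomData L.toPsMonData (prod M N).toPsMonData where
  hom := FiniteProducts.pair f.hom g.hom
  unitIso := lift₂Iso
    (eqToIso (comp_pair_fst_eq f g _) ≪≫ f.unitIso ≪≫ eqToIso (pair_fst _ _).symm)
    (eqToIso (comp_pair_snd_eq f g _) ≪≫ g.unitIso ≪≫ eqToIso (pair_snd _ _).symm)
  mulIso := lift₂Iso
    (eqToIso (comp_pair_fst_eq f g _) ≪≫ f.mulIso ≪≫
      eqToIso (by rw [PsMonData.ten_prodMul_fst, comp_pair_fst_eq, comp_pair_fst_eq]))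
    (eqToIso (comp_pair_snd_eq f g _) ≪≫ g.mulIso ≪≫
      eqToIso (by rw [PsMonData.ten_prodMul_snd, comp_pair_snd_eq, comp_pair_snd_eq]))

theorem pair_mulAt_fst (x y : X ⟶ L.obj) :
    ((pairData f g).mulAt x y).hom ▷ FiniteProducts.fst M.obj N.obj =
      eqToHom (comp_pair_fst_eq f g _) ≫ (f.mulAt x y).hom ≫
        eqToHom (by rw [PsMonData.ten_prodMul_fst, comp_pair_fst_eq, comp_pair_fst_eq]) := by
  simp only [MonHomData.mulAt_hom, comp_whiskerRight, eqToHom_whiskerRight, whisker_assoc',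
    lift₂Iso_hom, lift₂_fst, whiskerLeft_comp, whiskerLeft_eqToHom, Iso.trans_hom, eqToIso.hom]
  simp

theorem pair_mulAt_snd (x y : X ⟶ L.obj) :
    ((pairData f g).mulAt x y).hom ▷ FiniteProducts.snd M.obj N.obj =
      eqToHom (comp_pair_snd_eq f g _) ≫ (g.mulAt x y).hom ≫
        eqToHom (by rw [PsMonData.ten_prodMul_snd, comp_pair_snd_eq, comp_pair_snd_eq]) := by
  simp only [MonHomData.mulAt_hom, comp_whiskerRight, eqToHom_whiskerRight, whisker_assoc',
    lift₂Iso_hom, lift₂_snd, whiskerLeft_comp, whiskerLeft_eqToHom, Iso.trans_hom, eqToIso.hom]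
  simp

theorem pair_unitAt_fst :
    ((pairData f g).unitAt X).hom ▷ FiniteProducts.fst M.obj N.obj =
      eqToHom (comp_pair_fst_eq f g _) ≫ (f.unitAt X).hom ≫
        eqToHom (PsMonData.prodUnit_fst _ _).symm := by
  simp only [MonHomData.unitAt_hom, comp_whiskerRight, eqToHom_whiskerRight, whisker_assoc',
    lift₂Iso_hom, lift₂_fst, whiskerLeft_comp, whiskerLeft_eqToHom, Iso.trans_hom, eqToIso.hom]
  simp

theorem pair_unitAt_snd :
    ((pairData f g).unitAt X).hom ▷ FiniteProducts.snd M.obj N.obj =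
      eqToHom (comp_pair_snd_eq f g _) ≫ (g.unitAt X).hom ≫
        eqToHom (PsMonData.prodUnit_snd _ _).symm := by
  simp only [MonHomData.unitAt_hom, comp_whiskerRight, eqToHom_whiskerRight, whisker_assoc',
    lift₂Iso_hom, lift₂_snd, whiskerLeft_comp, whiskerLeft_eqToHom, Iso.trans_hom, eqToIso.hom]
  simp

theorem pair_assocAt (x y z : X ⟶ L.obj) : (pairData f g).AssocAt x y z := by
  have h₁ := f.assocAt x y z
  have h₂ := g.assocAt x y z
  simp only [MonHomData.AssocAt] at h₁ h₂ ⊢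
  refine hom_ext₂ ?_ ?_
  · simp only [comp_whiskerRight, PsMonData.tenMap_prodMul_fst, pair_mulAt_fst, id_whiskerRight,
      PsMonData.prod_assocAt_fst, id_conj (comp_pair_fst_eq f g x),
      id_conj (comp_pair_fst_eq f g z), tenMap_conj,
      M.assocAt_congr (comp_pair_fst_eq f g x) (comp_pair_fst_eq f g y) (comp_pair_fst_eq f g z),
      whiskerRight_whiskerRight (L.assocAt x y z).hom (pair_fst f.hom g.hom)]
    simp only [Category.assoc, eqToHom_trans, eqToHom_trans_assoc, eqToHom_refl, Category.id_comp]
    rw [reassoc_of% h₁]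
  · simp only [comp_whiskerRight, PsMonData.tenMap_prodMul_snd, pair_mulAt_snd, id_whiskerRight,
      PsMonData.prod_assocAt_snd, id_conj (comp_pair_snd_eq f g x),
      id_conj (comp_pair_snd_eq f g z), tenMap_conj,
      N.assocAt_congr (comp_pair_snd_eq f g x) (comp_pair_snd_eq f g y) (comp_pair_snd_eq f g z),
      whiskerRight_whiskerRight (L.assocAt x y z).hom (pair_snd f.hom g.hom)]
    simp only [Category.assoc, eqToHom_trans, eqToHom_trans_assoc, eqToHom_refl, Category.id_comp]
    rw [reassoc_of% h₂]

theorem pair_leftAt (x : X ⟶ L.obj) : (pairData f g).LeftAt x := by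
  have h₁ := f.leftAt x
  have h₂ := g.leftAt x
  simp only [MonHomData.LeftAt] at h₁ h₂ ⊢
  refine hom_ext₂ ?_ ?_
  · simp only [comp_whiskerRight, PsMonData.tenMap_prodMul_fst, pair_mulAt_fst, pair_unitAt_fst,
      id_whiskerRight, PsMonData.prod_leftAt_fst, id_conj (comp_pair_fst_eq f g x), tenMap_conj,
      M.leftAt_congr (comp_pair_fst_eq f g x),
      whiskerRight_whiskerRight (L.leftAt x).hom (pair_fst f.hom g.hom)]
    simp only [Category.assoc, eqToHom_trans, eqToHom_trans_assoc, eqToHom_refl, Category.id_comp]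
    rw [h₁]
    simp only [Category.assoc, Category.comp_id]
  · simp only [comp_whiskerRight, PsMonData.tenMap_prodMul_snd, pair_mulAt_snd, pair_unitAt_snd,
      id_whiskerRight, PsMonData.prod_leftAt_snd, id_conj (comp_pair_snd_eq f g x), tenMap_conj,
      N.leftAt_congr (comp_pair_snd_eq f g x),
      whiskerRight_whiskerRight (L.leftAt x).hom (pair_snd f.hom g.hom)]
    simp only [Category.assoc, eqToHom_trans, eqToHom_trans_assoc, eqToHom_refl, Category.id_comp]
    rw [h₂]
    simp only [Category.assoc, Category.comp_id]

theorem pair_rightAt (x : X ⟶ L.obj) : (pairData f g).RightAt x := by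
  have h₁ := f.rightAt x
  have h₂ := g.rightAt x
  simp only [MonHomData.RightAt] at h₁ h₂ ⊢
  refine hom_ext₂ ?_ ?_
  · simp only [comp_whiskerRight, PsMonData.tenMap_prodMul_fst, pair_mulAt_fst, pair_unitAt_fst,
      id_whiskerRight, PsMonData.prod_rightAt_fst, id_conj (comp_pair_fst_eq f g x), tenMap_conj,
      M.rightAt_congr (comp_pair_fst_eq f g x),
      whiskerRight_whiskerRight (L.rightAt x).hom (pair_fst f.hom g.hom)]
    simp only [Category.assoc, eqToHom_trans, eqToHom_trans_assoc, eqToHom_refl, Category.id_comp]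
    rw [h₁]
    simp only [Category.assoc, Category.comp_id]
  · simp only [comp_whiskerRight, PsMonData.tenMap_prodMul_snd, pair_mulAt_snd, pair_unitAt_snd,
      id_whiskerRight, PsMonData.prod_rightAt_snd, id_conj (comp_pair_snd_eq f g x), tenMap_conj,
      N.rightAt_congr (comp_pair_snd_eq f g x),
      whiskerRight_whiskerRight (L.rightAt x).hom (pair_snd f.hom g.hom)]
    simp only [Category.assoc, eqToHom_trans, eqToHom_trans_assoc, eqToHom_refl, Category.id_comp]
    rw [h₂]
    simp only [Category.assoc, Category.comp_id]

/-- The pairing of two strong monoidal morphisms. -/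
abbrev pair : MonHom L (prod M N) where
  toMonHomData := pairData f g
  assoc := pair_assocAt f g _ _ _
  left := pair_leftAt f g _
  right := pair_rightAt f g _

end PsMon

end

section

variable {K : Type u} [Bicategory.{w, v} K] [Bicategory.Strict K] [FiniteProducts K]

namespace PsMon

variable {L M N : PsMon K}

theorem comp_fst_mul (h : L ⟶ prod M N) : (h ≫ fst M N : MonHom L M).mulIso.hom =
    eqToHom (by rw [comp_hom, Strict.assoc]) ≫
      h.mulIso.hom ▷ FiniteProducts.fst M.obj N.obj ≫
        eqToHom (by rw [PsMonData.ten_prodMul_fst]; simp only [comp_hom, Strict.assoc]) := by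
  refine (MonHomData.comp_mulIso_hom _ _).trans ?_
  rw [fst_mulAt]
  simp

theorem comp_snd_mul (h : L ⟶ prod M N) : (h ≫ snd M N : MonHom L N).mulIso.hom =
    eqToHom (by rw [comp_hom, Strict.assoc]) ≫
      h.mulIso.hom ▷ FiniteProducts.snd M.obj N.obj ≫
        eqToHom (by rw [PsMonData.ten_prodMul_snd]; simp only [comp_hom, Strict.assoc]) := by
  refine (MonHomData.comp_mulIso_hom _ _).trans ?_
  rw [snd_mulAt]
  simp

theorem comp_fst_unit (h : L ⟶ prod M N) : (h ≫ fst M N : MonHom L M).unitIso.hom =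
    eqToHom (by rw [comp_hom, Strict.assoc]) ≫
      h.unitIso.hom ▷ FiniteProducts.fst M.obj N.obj ≫ eqToHom (pair_fst _ _) :=
  (MonHomData.comp_unitIso_hom _ _).trans (by simp)

theorem comp_snd_unit (h : L ⟶ prod M N) : (h ≫ snd M N : MonHom L N).unitIso.hom =
    eqToHom (by rw [comp_hom, Strict.assoc]) ≫
      h.unitIso.hom ▷ FiniteProducts.snd M.obj N.obj ≫ eqToHom (pair_snd _ _) :=
  (MonHomData.comp_unitIso_hom _ _).trans (by simp)

theorem mul_target_fst (h : L ⟶ prod M N) :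
    ten (PsMonData.prodMul M.toPsMonData N.toPsMonData)
        (FiniteProducts.fst L.obj L.obj ≫ h.hom) (FiniteProducts.snd L.obj L.obj ≫ h.hom) ≫
          FiniteProducts.fst M.obj N.obj =
      ten M.mul (FiniteProducts.fst L.obj L.obj ≫ (h ≫ fst M N : MonHom L M).hom)
        (FiniteProducts.snd L.obj L.obj ≫ (h ≫ fst M N : MonHom L M).hom) := by
  rw [PsMonData.ten_prodMul_fst]; simp only [comp_hom, Strict.assoc]

theorem mul_target_snd (h : L ⟶ prod M N) :
    ten (PsMonData.prodMul M.toPsMonData N.toPsMonData)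
        (FiniteProducts.fst L.obj L.obj ≫ h.hom) (FiniteProducts.snd L.obj L.obj ≫ h.hom) ≫
          FiniteProducts.snd M.obj N.obj =
      ten N.mul (FiniteProducts.fst L.obj L.obj ≫ (h ≫ snd M N : MonHom L N).hom)
        (FiniteProducts.snd L.obj L.obj ≫ (h ≫ snd M N : MonHom L N).hom) := by
  rw [PsMonData.ten_prodMul_snd]; simp only [comp_hom, Strict.assoc]

/-- The `2`-cell into a product with given components. -/
def lift₂ {h k : L ⟶ prod M N} (η : h ≫ fst M N ⟶ k ≫ fst M N)
    (θ : h ≫ snd M N ⟶ k ≫ snd M N) : h ⟶ k :=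
  MonCell.mk (FiniteProducts.lift₂ η.cell θ.cell)
    (by
      have h₁ := η.unit_cell
      have h₂ := θ.unit_cell
      rw [comp_fst_unit, comp_fst_unit] at h₁
      rw [comp_snd_unit, comp_snd_unit] at h₂
      refine hom_ext₂ ?_ ?_
      · rw [comp_whiskerRight, whisker_assoc', FiniteProducts.lift₂_fst]
        rw [← cancel_epi (eqToHom (Strict.assoc L.unit h.hom (FiniteProducts.fst M.obj N.obj)).symm),
          ← cancel_mono (eqToHom (pair_fst M.unit N.unit))]
        simpa using h₁
      · rw [comp_whiskerRight, whisker_assoc', FiniteProducts.lift₂_snd]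
        rw [← cancel_epi (eqToHom (Strict.assoc L.unit h.hom (FiniteProducts.snd M.obj N.obj)).symm),
          ← cancel_mono (eqToHom (pair_snd M.unit N.unit))]
        simpa using h₂)
    (by
      have h₁ := η.mul_cell
      have h₂ := θ.mul_cell
      rw [comp_fst_mul, comp_fst_mul] at h₁
      rw [comp_snd_mul, comp_snd_mul] at h₂
      refine hom_ext₂ ?_ ?_
      · simp only [comp_whiskerRight, whisker_assoc', FiniteProducts.lift₂_fst,
          PsMonData.tenMap_prodMul_fst, tenMap_conj]
        rw [← cancel_epi (eqToHom (Strict.assoc L.mul h.hom (FiniteProducts.fst M.obj N.obj)).symm),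
          ← cancel_mono (eqToHom (mul_target_fst k))]
        simpa [comp_hom, whisker_assoc', whiskerLeft_whiskerRight, tenMap_conj] using h₁
      · simp only [comp_whiskerRight, whisker_assoc', FiniteProducts.lift₂_snd,
          PsMonData.tenMap_prodMul_snd, tenMap_conj]
        rw [← cancel_epi (eqToHom (Strict.assoc L.mul h.hom (FiniteProducts.snd M.obj N.obj)).symm),
          ← cancel_mono (eqToHom (mul_target_snd k))]
        simpa [comp_hom, whisker_assoc', whiskerLeft_whiskerRight, tenMap_conj] using h₂)

theorem lift₂_fst {h k : L ⟶ prod M N} (η : h ≫ fst M N ⟶ k ≫ fst M N)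
    (θ : h ≫ snd M N ⟶ k ≫ snd M N) : lift₂ η θ ▷ (fst M N : prod M N ⟶ M) = η :=
  cell_ext (FiniteProducts.lift₂_fst η.cell θ.cell)

theorem lift₂_snd {h k : L ⟶ prod M N} (η : h ≫ fst M N ⟶ k ≫ fst M N)
    (θ : h ≫ snd M N ⟶ k ≫ snd M N) : lift₂ η θ ▷ (snd M N : prod M N ⟶ N) = θ :=
  cell_ext (FiniteProducts.lift₂_snd η.cell θ.cell)

theorem hom_ext {h k : L ⟶ prod M N} (e₁ : h ≫ fst M N = k ≫ fst M N)
    (e₂ : h ≫ snd M N = k ≫ snd M N) : h = k := by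
  refine hom_eq_of_cell (lift₂ (eqToHom e₁) (eqToHom e₂))
    (FiniteProducts.hom_ext (congrArg (fun l => l.hom) e₁) (congrArg (fun l => l.hom) e₂)) ?_
  refine hom_ext₂ ?_ ?_
  · refine (FiniteProducts.lift₂_fst _ _).trans ?_
    rw [eqToHom_cell, eqToHom_whiskerRight]
  · refine (FiniteProducts.lift₂_snd _ _).trans ?_
    rw [eqToHom_cell, eqToHom_whiskerRight]

theorem pair_comp_fst (f : L ⟶ M) (g : L ⟶ N) : (pair f g : L ⟶ prod M N) ≫ fst M N = f := by
  refine hom_eq_of_cell (MonCell.mk (eqToHom (pair_fst f.hom g.hom)) ?_ ?_)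
    (pair_fst f.hom g.hom) rfl
  · rw [comp_fst_unit]
    simp
  · rw [comp_fst_mul]
    simp

theorem pair_comp_snd (f : L ⟶ M) (g : L ⟶ N) : (pair f g : L ⟶ prod M N) ≫ snd M N = g := by
  refine hom_eq_of_cell (MonCell.mk (eqToHom (pair_snd f.hom g.hom)) ?_ ?_)
    (pair_snd f.hom g.hom) rfl
  · rw [comp_snd_unit]
    simp
  · rw [comp_snd_mul]
    simp

theorem bang_uniq (f : L ⟶ one) : f = bang L :=
  hom_eq_of_cell (MonCell.mk (eqToHom (FiniteProducts.bang_uniq f.hom)) (bang_ext₂ _ _)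
    (bang_ext₂ _ _)) (FiniteProducts.bang_uniq f.hom) rfl

end PsMon

/-- The products in `K` lift to the `2`-category of pseudo monoids. -/
instance : FiniteProducts (PsMon K) where
  one := PsMon.one
  bang := PsMon.bang
  bang_uniq := PsMon.bang_uniq
  bang_ext₂ _ _ := PsMon.cell_ext (bang_ext₂ _ _)
  prod := PsMon.prod
  fst := PsMon.fst
  snd := PsMon.snd
  pair := PsMon.pair
  pair_fst := PsMon.pair_comp_fst
  pair_snd := PsMon.pair_comp_snd
  hom_ext := PsMon.hom_ext
  lift₂ := PsMon.lift₂
  lift₂_fst := PsMon.lift₂_fst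
  lift₂_snd := PsMon.lift₂_snd
  hom_ext₂ h₁ h₂ := PsMon.cell_ext (hom_ext₂ (congrArg (fun c => c.cell) h₁)
    (congrArg (fun c => c.cell) h₂))

end

section

/-- The forgetful `2`-functor, sending a pseudo monoid to its underlying object. -/
def forget (K : Type u) [Bicategory.{w, v} K] [Bicategory.Strict K] [FiniteProducts K] :
    StrictPseudofunctor (PsMon K) K :=
  StrictPseudofunctor.mk''
    { obj := fun M => M.obj
      map := fun f => f.hom
      map₂ := fun η => η.cell
      map₂_id := fun _ => rfl
      map₂_comp := fun _ _ => rfl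
      map_id := fun _ => rfl
      map_comp := fun _ _ => rfl
      map₂_whisker_left := by intros; simp; rfl
      map₂_whisker_right := by intros; simp; rfl }

end

universe w₁ v₁ u₁ w₂ v₂ u₂

section

variable {B : Type u₁} [Bicategory.{w₁, v₁} B] {C : Type u₂} [Bicategory.{w₂, v₂} C]

/-- A (strict) `2`-natural isomorphism between `2`-functors: a family of isomorphisms
`F X ≅ G X`, natural with respect to `1`-cells and `2`-cells. -/
structure TwoNatIso (F G : StrictPseudofunctor B C) where
  hom (X : B) : F.obj X ⟶ G.obj X
  inv (X : B) : G.obj X ⟶ F.obj X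
  hom_inv (X : B) : hom X ≫ inv X = 𝟙 (F.obj X)
  inv_hom (X : B) : inv X ≫ hom X = 𝟙 (G.obj X)
  naturality {X Y : B} (f : X ⟶ Y) : F.map f ≫ hom Y = hom X ≫ G.map f
  naturality₂ {X Y : B} {f g : X ⟶ Y} (η : f ⟶ g) :
    F.map₂ η ▷ hom Y ≫ eqToHom (naturality g) = eqToHom (naturality f) ≫ hom X ◁ G.map₂ η

/-- A `2`-functor is a `2`-equivalence (an equivalence in the `Cat`-enriched sense) if it has an
inverse `2`-functor up to `2`-natural isomorphism. -/
def IsTwoEquivalence (F : StrictPseudofunctor B C) : Prop :=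
  ∃ G : StrictPseudofunctor C B,
    Nonempty (TwoNatIso (F.comp G) (StrictPseudofunctor.id B)) ∧
      Nonempty (TwoNatIso (G.comp F) (StrictPseudofunctor.id C))

end
end TwoCat

/-! The theorem is a two-dimensional Eckmann–Hilton argument: after enough iterations a 2-category
becomes so additive that a pseudo monoid structure on an object is unique and is respected by every
1-cell and 2-cell. Three properties measure this additivity. `PseudoPointed` makes any two points of
an object uniquely isomorphic. `ProdFaithful` and `ProdFull` say that 2-cells between 1-cells out of
a product correspond to pairs of 2-cells between their restrictions to the two factors.

The properties appear one level at a time. For every base, pseudo monoids satisfy the first two: a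
strong monoidal morphism out of the terminal object is determined up to unique isomorphism by its
unit constraint, and in a product (a, b) is isomorphic to (a, 0) ⊗ (0, b) (`MonHom.split`), so a
monoidal 2-cell is recovered from its restrictions. The same formula glues two 2-cells into one on
the product (`MonHom.glue`), but only as a 2-cell of the base. It is monoidal as soon as the base
already has the first two properties, because then every 2-cell between strong monoidal morphisms is
monoidal (`MonCell.ofCell`). Two levels therefore give all three properties (`PsMon.prodFull`), and
further levels keep them.

In a 2-category with all three, every 1-cell between underlying objects carries a strong monoidal
structure (`exists_monHom`): the unit axioms prescribe φ₂ on the two factors, fullness produces it,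
and faithfulness reduces the associativity axiom to arguments containing a unit, where it follows
from the unit axioms. By `MonHom.ext_hom` the structure is unique. Applied to the unit and
multiplication of a pseudo monoid, this makes the pseudo monoid one over itself (`double`); applied
to an identity 1-cell, it identifies any second structure with the repeated one. Hence `double` is
inverse to forgetting, up to 2-natural isomorphism. -/

namespace TwoCat

open FiniteProducts

/-! ### Generalised elements as monoidal categories, and Kelly's unit coherence. -/

section HomCategories

variable {K : Type u} [Bicategory.{w, v} K] [Bicategory.Strict K] [FiniteProducts K]

/-- The generalised elements of a pseudo monoid at `X`, as a category. -/
abbrev Elt (M : PsMon K) (X : K) := X ⟶ M.obj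

/-- The generalised elements of a pseudo monoid at a given object form a monoidal category. -/
@[reducible]
def eltMonoidal (M : PsMon K) (X : K) : MonoidalCategory (Elt M X) :=
  letI : MonoidalCategoryStruct (Elt M X) :=
    { tensorObj := fun x y => ten M.mul x y
      tensorHom := fun η θ => tenMap M.mul η θ
      whiskerLeft := fun x _ _ θ => tenMap M.mul (𝟙 x) θ
      whiskerRight := fun η y => tenMap M.mul η (𝟙 y)
      tensorUnit := bang X ≫ M.unit
      associator := M.assocAt
      leftUnitor := M.leftAt
      rightUnitor := M.rightAt }
  MonoidalCategory.ofTensorHom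
    (id_tensorHom_id := fun x y => tenMap_id M.mul x y)
    (tensorHom_comp_tensorHom := fun _ _ _ _ => (tenMap_comp M.mul _ _ _ _).symm)
    (associator_naturality := fun _ _ _ => M.assocAt_naturality _ _ _)
    (leftUnitor_naturality := fun _ => M.leftAt_naturality _)
    (rightUnitor_naturality := fun η => M.rightAt_naturality η)
    (pentagon := fun w x y z => M.pentagonAt w x y z)
    (triangle := fun x y => M.triangleAt x y)

variable (M : PsMon K) {X : K}

/-- One of Kelly's consequences of the pentagon and triangle, imported from monoidal categories
through `eltMonoidal`. It drives the associativity check when the first argument is the unit. -/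
theorem leftAt_ten (x y : X ⟶ M.obj) :
    (M.assocAt (bang X ≫ M.unit) x y).hom ≫ (M.leftAt (ten M.mul x y)).hom =
      tenMap M.mul (M.leftAt x).hom (𝟙 y) := by
  let _ := eltMonoidal M X
  have := MonoidalCategory.leftUnitor_whiskerRight (C := Elt M X) x y
  exact this.symm

/-- The other consequence of Kelly's argument that is needed. It makes the two unitors agree at a
point in `MonHom.leftPt_self`. -/
theorem leftAt_unit :
    (M.leftAt (bang X ≫ M.unit)).hom = (M.rightAt (bang X ≫ M.unit)).hom :=
  let _ := eltMonoidal M X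
  (MonoidalCategory.unitors_equal (C := Elt M X) :)

end HomCategories

/-! ### Compatibility of a 2-cell with φ₂, tested at generalised elements. -/

section Elements

/-- Meant for 1-cells such as the pairing of the two projections, which equals the identity but not
by definition. -/
theorem eq_of_whiskerLeft_id {K : Type u} [Bicategory.{w, v} K] {A B : K} {h : A ⟶ A}
    (e : h = 𝟙 A) {f g : A ⟶ B} {η θ : f ⟶ g}
    (H : h ◁ η = h ◁ θ) : η = θ := by
  subst e
  simpa using H

variable {K : Type u} [Bicategory.{w, v} K] [FiniteProducts K]

instance tenMap_isIso {A : K} (m : prod A A ⟶ A) {X : K} {x x' y y' : X ⟶ A} (η : x ⟶ x')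
    (θ : y ⟶ y') [IsIso η] [IsIso θ] : IsIso (tenMap m η θ) :=
  ⟨tenMap m (inv η) (inv θ), by simp [← tenMap_comp], by simp [← tenMap_comp]⟩

variable [Bicategory.Strict K]

namespace MonHomData

variable {M N : PsMonData K} {X Y : K}

/-- Compatibility of a `2`-cell with `φ₂` at generalised elements. -/
def MulCellAt (f g : MonHomData M N) (η : f.hom ⟶ g.hom) (x y : X ⟶ M.obj) : Prop :=
  ten M.mul x y ◁ η ≫ (g.mulAt x y).hom =
    (f.mulAt x y).hom ≫ tenMap N.mul (x ◁ η) (y ◁ η)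

/-- The condition at (x, y) is the universal condition whiskered with `pair x y`, up to identity
2-cells. Taking one of x, y to be an identity and the other the constant unit turns it into a
restriction along `inl` or `inr`, the shape that `ProdFaithful` asks for. -/
theorem mulCellAt_iff {f g : MonHomData M N} (η : f.hom ⟶ g.hom) (x y : X ⟶ M.obj) :
    MulCellAt f g η x y ↔
      pair x y ◁ (M.mul ◁ η ≫ g.mulIso.hom) =
        pair x y ◁ (f.mulIso.hom ≫ tenMap N.mul (fst M.obj M.obj ◁ η) (snd M.obj M.obj ◁ η)) := by
  simp only [MulCellAt, whiskerLeft_comp, whiskerLeft_tenMap, whiskerLeft_whiskerLeft (pair_fst x y),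
    whiskerLeft_whiskerLeft (pair_snd x y), tenMap_conj,
    whiskerLeft_whiskerLeft (show pair x y ≫ M.mul = ten M.mul x y from rfl), MonHomData.mulAt_hom]
  rw [← cancel_epi (eqToHom (ten_comp M.mul x y f.hom).symm),
    ← cancel_mono (eqToHom (g.comp_ten_hom x y).symm)]
  simp

theorem mul_cell_of_mulCellAt {f g : MonHomData M N} (η : f.hom ⟶ g.hom)
    (H : MulCellAt f g η (fst M.obj M.obj) (snd M.obj M.obj)) :
    M.mul ◁ η ≫ g.mulIso.hom =
      f.mulIso.hom ≫ tenMap N.mul (fst M.obj M.obj ◁ η) (snd M.obj M.obj ◁ η) :=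
  eq_of_whiskerLeft_id (pair_eta _ _) ((mulCellAt_iff η _ _).1 H)

theorem unitAt_cell {f g : MonHomData M N} (η : f.hom ⟶ g.hom)
    (H : M.unit ◁ η ≫ g.unitIso.hom = f.unitIso.hom) (X : K) :
    (bang X ≫ M.unit) ◁ η ≫ (g.unitAt X).hom = (f.unitAt X).hom := by
  rw [unitAt_hom, unitAt_hom, ← H, comp_whiskerLeft']
  simp

/-- A `2`-cell compatible with `φ₀` is compatible with `φ₂` when the right argument is the unit. -/
theorem mulCellAt_unit_right {f g : MonHomData M N} (η : f.hom ⟶ g.hom)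
    (H : M.unit ◁ η ≫ g.unitIso.hom = f.unitIso.hom) {x : X ⟶ M.obj} (hf : f.RightAt x)
    (hg : g.RightAt x) : MulCellAt f g η x (bang X ≫ M.unit) := by
  -- The unit axiom factors the image of ρ as φ₂ followed by invertible cells, so naturality of ρ
  -- against `η` becomes the compatibility with φ₂ once those cells are cancelled.
  have n := whisker_exchange (M.rightAt x).hom η
  have m := N.rightAt_naturality (x ◁ η)
  unfold RightAt at hf hg
  rw [hf, hg] at n
  simp only [Category.assoc] at n
  rw [← m] at n
  unfold MulCellAt
  -- What is left after cancelling is the interchange of `x ◁ η` with φ₀, where φ₀ of `f` is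
  -- rewritten through that of `g` by the unit compatibility of `η`.
  rw [← cancel_mono (tenMap N.mul (𝟙 (x ≫ g.hom)) (g.unitAt X).hom ≫ (N.rightAt (x ≫ g.hom)).hom),
    Category.assoc, n, ← unitAt_cell η H X]
  simp only [← Category.assoc]
  congr 1
  simp only [Category.assoc]
  simp only [← tenMap_comp, Category.comp_id, Category.id_comp]

/-- A `2`-cell compatible with `φ₀` is compatible with `φ₂` when the left argument is the unit. -/
theorem mulCellAt_unit_left {f g : MonHomData M N} (η : f.hom ⟶ g.hom)
    (H : M.unit ◁ η ≫ g.unitIso.hom = f.unitIso.hom) {x : X ⟶ M.obj} (hf : f.LeftAt x)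
    (hg : g.LeftAt x) : MulCellAt f g η (bang X ≫ M.unit) x := by
  have n := whisker_exchange (M.leftAt x).hom η
  have m := N.leftAt_naturality (x ◁ η)
  unfold LeftAt at hf hg
  rw [hf, hg] at n
  simp only [Category.assoc] at n
  rw [← m] at n
  unfold MulCellAt
  rw [← cancel_mono (tenMap N.mul (g.unitAt X).hom (𝟙 (x ≫ g.hom)) ≫ (N.leftAt (x ≫ g.hom)).hom),
    Category.assoc, n, ← unitAt_cell η H X]
  simp only [← Category.assoc]
  congr 1
  simp only [Category.assoc]
  simp only [← tenMap_comp, Category.comp_id, Category.id_comp]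

end MonHomData
end Elements

/-! ### The three additivity conditions on a 2-category. -/

section Conditions

variable (K : Type u) [Bicategory.{w, v} K] [FiniteProducts K]

/-- The terminal object is also weakly initial on `2`-cells: two `1`-cells out of it are related by
exactly one `2`-cell. -/
class PseudoPointed : Prop where
  exists_cell {X : K} (f g : one ⟶ X) : Nonempty (f ⟶ g)
  cell_ext {X : K} {f g : one ⟶ X} (η θ : f ⟶ g) : η = θ

variable {K}

/-- The inclusion `(1, j)` of the first factor of a product. -/
def inl (A : K) {B : K} (j : one ⟶ B) : A ⟶ prod A B := pair (𝟙 A) (bang A ≫ j)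

/-- The inclusion `(i, 1)` of the second factor of a product. -/
def inr {A : K} (B : K) (i : one ⟶ A) : B ⟶ prod A B := pair (bang B ≫ i) (𝟙 B)

variable (K)

/-- `2`-cells between `1`-cells out of a product are determined by their restrictions to the
factors. -/
class ProdFaithful : Prop where
  ext {A B X : K} (i : one ⟶ A) (j : one ⟶ B) {g h : prod A B ⟶ X} {ζ ξ : g ⟶ h} :
    inl A j ◁ ζ = inl A j ◁ ξ → inr B i ◁ ζ = inr B i ◁ ξ → ζ = ξ

/-- `2`-cells on the factors extend to the product. -/
class ProdFull : Prop where
  exists_ext {A B X : K} (i : one ⟶ A) (j : one ⟶ B) {g h : prod A B ⟶ X}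
    (α : inl A j ≫ g ⟶ inl A j ≫ h) (β : inr B i ≫ g ⟶ inr B i ≫ h) :
    ∃ ζ : g ⟶ h, inl A j ◁ ζ = α ∧ inr B i ◁ ζ = β

end Conditions

/-! ### Pseudo monoids are pointed, over any base. -/

section Pointed

variable {K : Type u} [Bicategory.{w, v} K] [Bicategory.Strict K] [FiniteProducts K]

namespace MonHom

variable {N : PsMon K}

/-- Strong monoidal morphisms out of the terminal pseudo monoid are related by a `2`-cell. -/
theorem nonempty_cell_of_one (f g : MonHom (PsMon.one : PsMon K) N) : Nonempty (MonCell f g) := by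
  let e : f.hom ⟶ g.hom := eqToHom (Strict.id_comp _).symm ≫ f.unitIso.hom ≫ g.unitIso.inv ≫
    eqToHom (Strict.id_comp _)
  have h : (PsMon.one : PsMon K).unit ◁ e ≫ g.unitIso.hom = f.unitIso.hom := by
    simp only [e, id_whiskerLeft']
    simp
  refine ⟨MonCell.mk e h (MonHomData.mul_cell_of_mulCellAt e ?_)⟩
  -- All 1-cells into the terminal object coincide, so the second argument of the multiplication is
  -- already the unit and the unit case of the compatibility is the whole of it.
  rw [show snd (PsMon.one : PsMon K).obj (PsMon.one : PsMon K).obj =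
    bang _ ≫ (PsMon.one : PsMon K).unit from (bang_uniq _).trans (bang_uniq _).symm]
  exact MonHomData.mulCellAt_unit_right e h (f.rightAt _) (g.rightAt _)

/-- The unit of the terminal pseudo monoid is an identity, so compatibility with the invertible φ₀
leaves no freedom for the 2-cell. -/
theorem cell_ext_of_one {f g : MonHom (PsMon.one : PsMon K) N} (η θ : MonCell f g) : η = θ := by
  refine MonCell.ext (eq_of_whiskerLeft_id (h := (PsMon.one : PsMon K).unit) rfl ?_)
  rw [← cancel_mono g.unitIso.hom]
  exact η.unit_cell.trans θ.unit_cell.symm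

end MonHom

instance PsMon.pseudoPointed : PseudoPointed (PsMon K) where
  exists_cell f g := MonHom.nonempty_cell_of_one f g
  cell_ext η θ := MonHom.cell_ext_of_one η θ

end Pointed
-- Monoidality of 2-cells becomes automatic.
section MonCells

variable {K : Type u} [Bicategory.{w, v} K] [Bicategory.Strict K] [FiniteProducts K]

/-- If `2`-cells out of products are determined by their restrictions to the factors, then every
`2`-cell between strong monoidal morphisms is monoidal. -/
def MonCell.ofCell [PseudoPointed K] [ProdFaithful K] {M N : PsMon K} {f g : MonHom M N}
    (η : f.hom ⟶ g.hom) : MonCell f g :=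
  -- Both sides are 2-cells between points, hence equal.
  have h : M.unit ◁ η ≫ g.unitIso.hom = f.unitIso.hom := PseudoPointed.cell_ext _ _
  MonCell.mk η h
    -- The φ₂ axiom is an equation of 2-cells out of a product. With `M.unit` as base point in both
    -- factors, its two restrictions are the cases where one argument is the unit.
    (ProdFaithful.ext M.unit M.unit
      ((MonHomData.mulCellAt_iff η _ _).1
        (MonHomData.mulCellAt_unit_right η h (f.rightAt _) (g.rightAt _)))
      ((MonHomData.mulCellAt_iff η _ _).1
        (MonHomData.mulCellAt_unit_left η h (f.leftAt _) (g.leftAt _))))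

/-- The identity 2-cell of the common underlying 1-cell is automatically monoidal, which forces φ₀
and φ₂ to agree. A 1-cell therefore has at most one strong monoidal structure. -/
theorem MonHom.ext_hom [PseudoPointed K] [ProdFaithful K] {M N : PsMon K} {f g : MonHom M N}
    (e : f.hom = g.hom) : f = g :=
  MonCell.eq_of_cell (MonCell.ofCell (eqToHom e)) e rfl

end MonCells

/-! ### Unitors relative to an arbitrary point, which is only isomorphic to the unit. -/

section PointedUnitors

variable {K : Type u} [Bicategory.{w, v} K] [Bicategory.Strict K] [FiniteProducts K]

/-- An invertible tensor product of `2`-cells. -/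
@[simps]
def tenMapIso {A : K} (m : prod A A ⟶ A) {X : K} {x x' y y' : X ⟶ A} (η : x ≅ x') (θ : y ≅ y') :
    ten m x y ≅ ten m x' y' where
  hom := tenMap m η.hom θ.hom
  inv := tenMap m η.inv θ.inv
  hom_inv_id := by simp [← tenMap_comp]
  inv_hom_id := by simp [← tenMap_comp]

theorem MonHomData.whiskerLeft_mulAt_inv {M N : PsMonData K} (f : MonHomData M N) {X Y : K}
    (h : Y ⟶ X) {x y : X ⟶ M.obj} {x' y' : Y ⟶ M.obj} (ex : h ≫ x = x') (ey : h ≫ y = y') :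
    h ◁ (f.mulAt x y).inv =
      eqToHom (by rw [comp_ten, ← ex, ← ey, Strict.assoc, Strict.assoc]) ≫
        (f.mulAt x' y').inv ≫ eqToHom (by rw [← Strict.assoc, comp_ten, ex, ey]) := by
  subst ex ey
  simp [mulAt, whiskerLeft_whiskerLeft (comp_pair h x y)]

namespace MonHom

variable {A B : PsMon K} {X Y : K}

/-- A strong monoidal morphism out of the terminal pseudo monoid is isomorphic to the unit. -/
def ptIso (i : MonHom (PsMon.one : PsMon K) A) (X : K) : bang X ≫ i.hom ≅ bang X ≫ A.unit :=
  whiskerLeftIso (bang X) (eqToIso (Strict.id_comp i.hom).symm ≪≫ i.unitIso)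

/-- The right unitor with the unit replaced by a strong monoidal morphism out of the terminal
pseudo monoid. -/
def rightPt (i : MonHom (PsMon.one : PsMon K) A) (x : X ⟶ A.obj) :
    ten A.mul x (bang X ≫ i.hom) ≅ x :=
  tenMapIso A.mul (Iso.refl x) (i.ptIso X) ≪≫ A.rightAt x

/-- The left unitor with the unit replaced by a strong monoidal morphism out of the terminal
pseudo monoid. -/
def leftPt (i : MonHom (PsMon.one : PsMon K) A) (x : X ⟶ A.obj) :
    ten A.mul (bang X ≫ i.hom) x ≅ x :=
  tenMapIso A.mul (i.ptIso X) (Iso.refl x) ≪≫ A.leftAt x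

variable (i : MonHom (PsMon.one : PsMon K) A)

theorem rightPt_hom (x : X ⟶ A.obj) :
    (i.rightPt x).hom = tenMap A.mul (𝟙 x) (i.ptIso X).hom ≫ (A.rightAt x).hom := rfl

theorem leftPt_hom (x : X ⟶ A.obj) :
    (i.leftPt x).hom = tenMap A.mul (i.ptIso X).hom (𝟙 x) ≫ (A.leftAt x).hom := rfl

theorem whiskerLeft_ptIso (h : Y ⟶ X) :
    h ◁ (i.ptIso X).hom = eqToHom (by rw [← Strict.assoc, comp_bang]) ≫ (i.ptIso Y).hom ≫
      eqToHom (by rw [← Strict.assoc, comp_bang]) := by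
  simp [ptIso, whiskerLeft_whiskerLeft (comp_bang h)]

theorem whiskerLeft_rightPt (h : Y ⟶ X) {x : X ⟶ A.obj} {x' : Y ⟶ A.obj} (e : h ≫ x = x') :
    h ◁ (i.rightPt x).hom =
      eqToHom (by rw [comp_ten, ← Strict.assoc, comp_bang, e]) ≫ (i.rightPt x').hom ≫
        eqToHom e.symm := by
  subst e
  simp only [rightPt_hom, whiskerLeft_comp, whiskerLeft_tenMap, whiskerLeft_id,
    A.whiskerLeft_rightAt h rfl, whiskerLeft_ptIso, tenMap_conj_right]
  simp

theorem whiskerLeft_leftPt (h : Y ⟶ X) {x : X ⟶ A.obj} {x' : Y ⟶ A.obj} (e : h ≫ x = x') :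
    h ◁ (i.leftPt x).hom =
      eqToHom (by rw [comp_ten, ← Strict.assoc, comp_bang, e]) ≫ (i.leftPt x').hom ≫
        eqToHom e.symm := by
  subst e
  simp only [leftPt_hom, whiskerLeft_comp, whiskerLeft_tenMap, whiskerLeft_id,
    A.whiskerLeft_leftAt h rfl, whiskerLeft_ptIso, tenMap_conj_left]
  simp

variable {i}

theorem ptIso_cell {i' : MonHom (PsMon.one : PsMon K) A} (ω : MonCell i i') (X : K) :
    bang X ◁ ω.cell ≫ (i'.ptIso X).hom = (i.ptIso X).hom := by
  have e : ω.cell ≫ eqToHom (Strict.id_comp _).symm ≫ i'.unitIso.hom =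
      eqToHom (Strict.id_comp _).symm ≫ i.unitIso.hom := by
    rw [← ω.unit_cell, id_whiskerLeft' ω.cell]
    simp
  exact (whiskerLeft_comp _ _ _).symm.trans (congrArg (bang X ◁ ·) e)

/-- Naturality holds in the point as well as in the element, because a monoidal `ω` commutes with
the comparisons of the two points with the unit. -/
theorem rightPt_naturality {i' : MonHom (PsMon.one : PsMon K) A} (ω : MonCell i i')
    {x x' : X ⟶ A.obj} (η : x ⟶ x') :
    tenMap A.mul η (bang X ◁ ω.cell) ≫ (i'.rightPt x').hom = (i.rightPt x).hom ≫ η := by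
  rw [rightPt_hom, rightPt_hom, Category.assoc, ← A.rightAt_naturality, ← ptIso_cell ω]
  simp only [← Category.assoc]
  simp only [← tenMap_comp, Category.comp_id, Category.id_comp]

theorem leftPt_naturality {i' : MonHom (PsMon.one : PsMon K) A} (ω : MonCell i i')
    {x x' : X ⟶ A.obj} (η : x ⟶ x') :
    tenMap A.mul (bang X ◁ ω.cell) η ≫ (i'.leftPt x').hom = (i.leftPt x).hom ≫ η := by
  rw [leftPt_hom, leftPt_hom, Category.assoc, ← A.leftAt_naturality, ← ptIso_cell ω]
  simp only [← Category.assoc]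
  simp only [← tenMap_comp, Category.comp_id, Category.id_comp]

/-- This is `leftAt_unit` transported along the isomorphism of the point with the unit. -/
theorem leftPt_self : (i.leftPt (bang X ≫ i.hom)).hom = (i.rightPt (bang X ≫ i.hom)).hom := by
  rw [leftPt_hom, rightPt_hom, ← cancel_mono (i.ptIso X).hom, Category.assoc, Category.assoc,
    ← A.leftAt_naturality, ← A.rightAt_naturality, leftAt_unit]
  simp only [← Category.assoc]
  simp only [← tenMap_comp, Category.comp_id, Category.id_comp]

theorem rightPt_congr {i' : MonHom (PsMon.one : PsMon K) A} (ei : i = i') {x x' : X ⟶ A.obj}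
    (ex : x = x') : (i.rightPt x).hom =
      eqToHom (by rw [ei, ex]) ≫ (i'.rightPt x').hom ≫ eqToHom ex.symm := by
  subst ei ex; simp

theorem leftPt_congr {i' : MonHom (PsMon.one : PsMon K) A} (ei : i = i') {x x' : X ⟶ A.obj}
    (ex : x = x') : (i.leftPt x).hom =
      eqToHom (by rw [ei, ex]) ≫ (i'.leftPt x').hom ≫ eqToHom ex.symm := by
  subst ei ex; simp

theorem comp_ptIso (g : MonHom A B) :
    ((i.comp g).ptIso X).hom = eqToHom (Strict.assoc _ _ _).symm ≫ (i.ptIso X).hom ▷ g.hom ≫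
      (g.unitAt X).hom := by
  simp [ptIso, MonHomData.unitAt_hom, Strict.associator_eqToIso]

/-- The right unit axiom of `g` in pointed form: φ₀ disappears from the formula, being absorbed into
the comparison of the image point `i.comp g` with the unit. -/
theorem rightPt_whiskerRight (g : MonHom A B) (x : X ⟶ A.obj) :
    (i.rightPt x).hom ▷ g.hom = (g.mulAt x (bang X ≫ i.hom)).hom ≫
      eqToHom (by rw [Strict.assoc]) ≫ ((i.comp g).rightPt (x ≫ g.hom)).hom := by
  have h := g.rightAt x
  have n := g.mulAt_naturality (𝟙 x) (i.ptIso X).hom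
  unfold MonHomData.RightAt at h
  rw [rightPt_hom, rightPt_hom, comp_whiskerRight, h, reassoc_of% n, comp_ptIso, id_whiskerRight,
    tenMap_comp_right, tenMap_comp_right, tenMap_eqToHom_right]
  simp

theorem leftPt_whiskerRight (g : MonHom A B) (x : X ⟶ A.obj) :
    (i.leftPt x).hom ▷ g.hom = (g.mulAt (bang X ≫ i.hom) x).hom ≫
      eqToHom (by rw [Strict.assoc]) ≫ ((i.comp g).leftPt (x ≫ g.hom)).hom := by
  have h := g.leftAt x
  have n := g.mulAt_naturality (i.ptIso X).hom (𝟙 x)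
  unfold MonHomData.LeftAt at h
  rw [leftPt_hom, leftPt_hom, comp_whiskerRight, h, reassoc_of% n, comp_ptIso, id_whiskerRight,
    tenMap_comp_left, tenMap_comp_left, tenMap_eqToHom_left]
  simp

end MonHom
end PointedUnitors
-- The decomposition (a, b) ≅ (a, 0) ⊗ (0, b) in a product of pseudo monoids.
section Split

variable {K : Type u} [Bicategory.{w, v} K] [Bicategory.Strict K] [FiniteProducts K]

section

variable {A B : K}

theorem inl_fst (j : one ⟶ B) : inl A j ≫ fst A B = 𝟙 A := pair_fst _ _

theorem inl_snd (j : one ⟶ B) : inl A j ≫ snd A B = bang A ≫ j := pair_snd _ _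

theorem inr_fst (i : one ⟶ A) : inr B i ≫ fst A B = bang B ≫ i := pair_fst _ _

theorem inr_snd (i : one ⟶ A) : inr B i ≫ snd A B = 𝟙 B := pair_snd _ _

theorem split_fst_eq (m : prod A A ⟶ A) (i : one ⟶ A) (j : one ⟶ B):
    ten m ((fst A B ≫ inl A j) ≫ fst A B)
      ((snd A B ≫ inr B i) ≫ fst A B) = 
    ten m (fst A B) (bang (prod A B) ≫ i) := by
  simp only [inl, inr, Strict.assoc, pair_fst, Strict.comp_id]
  rw [← Strict.assoc, comp_bang]

theorem split_snd_eq (m : prod B B ⟶ B) (i : one ⟶ A) (j : one ⟶ B):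
    ten m ((fst A B ≫ inl A j) ≫ snd A B)
      ((snd A B ≫ inr B i) ≫ snd A B) = 
    ten m (bang (prod A B) ≫ j) (snd A B) := by
  simp only [inl, inr, Strict.assoc, pair_snd, Strict.comp_id]
  rw [← Strict.assoc, comp_bang]

theorem inl_fst_inl (j : one ⟶ B) :
    inl A j ≫ fst A B ≫ inl A j = inl A j := by
  rw [← Strict.assoc]; simp [inl]

theorem inr_snd_inr (i : one ⟶ A) :
    inr B i ≫ snd A B ≫ inr B i = inr B i := by
  rw [← Strict.assoc]; simp [inr]

theorem inl_snd_inr (i : one ⟶ A) (j : one ⟶ B) :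
    inl A j ≫ snd A B ≫ inr B i = bang A ≫ pair i j := by
  apply hom_ext
  · simp only [inl, inr, Strict.assoc, pair_fst, pair_snd, pair_snd_comp, comp_bang,
      ← Strict.assoc _ _ i]
  · simp [inl, inr, Strict.assoc, pair_fst, pair_snd, pair_snd_comp]

theorem inr_fst_inl (i : one ⟶ A) (j : one ⟶ B) :
    inr B i ≫ fst A B ≫ inl A j = bang B ≫ pair i j := by
  apply hom_ext
  · simp [inl, inr, Strict.assoc, pair_fst, pair_snd, pair_fst_comp]
  · simp only [inl, inr, Strict.assoc, pair_fst, pair_snd, pair_fst_comp, comp_bang,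
      ← Strict.assoc _ _ j]

end

namespace MonHom

variable {A B : PsMon K} (i : MonHom (PsMon.one : PsMon K) A) (j : MonHom (PsMon.one : PsMon K) B)

/-- In a product of pseudo monoids, `(a, b)` is isomorphic to `(a, 0) ⊗ (0, b)`. -/
def split : ten (PsMon.prod A B).mul
    (fst A.obj B.obj ≫ inl A.obj j.hom)
    (snd A.obj B.obj ≫ inr B.obj i.hom) ≅ 𝟙 (prod A.obj B.obj) :=
  lift₂Iso
    (eqToIso ((PsMonData.ten_prodMul_fst _ _).trans (split_fst_eq _ _ _)) ≪≫
      i.rightPt _ ≪≫ eqToIso (Strict.id_comp _).symm)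
    (eqToIso ((PsMonData.ten_prodMul_snd _ _).trans (split_snd_eq _ _ _)) ≪≫
      j.leftPt _ ≪≫ eqToIso (Strict.id_comp _).symm)

theorem split_fst : (split i j).hom ▷ fst A.obj B.obj =
    eqToHom ((PsMonData.ten_prodMul_fst _ _).trans (split_fst_eq _ _ _)) ≫
      (i.rightPt _).hom ≫ eqToHom (Strict.id_comp _).symm :=
  lift₂_fst _ _

theorem split_snd : (split i j).hom ▷ snd A.obj B.obj =
    eqToHom ((PsMonData.ten_prodMul_snd _ _).trans (split_snd_eq _ _ _)) ≫
      (j.leftPt _).hom ≫ eqToHom (Strict.id_comp _).symm :=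
  lift₂_snd _ _

/-- The projection is strictly monoidal, so `rightPt_whiskerRight` has only identity cells in the
place of φ₂. -/
theorem rightPt_prod_fst {X : K} (x : X ⟶ prod A.obj B.obj) :
    ((PsMon.pair i j).rightPt x).hom ▷ fst A.obj B.obj =
      eqToHom (by rw [PsMonData.ten_prodMul_fst, Strict.assoc, pair_fst]) ≫
        (i.rightPt (x ≫ fst A.obj B.obj)).hom := by
  refine (MonHom.rightPt_whiskerRight (PsMon.fst A B) x).trans ?_
  rw [PsMon.fst_mulAt, MonHom.rightPt_congr
    (show (PsMon.pair i j).comp (PsMon.fst A B) = i from PsMon.pair_comp_fst i j)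
    (rfl : x ≫ (PsMon.fst A B).hom = x ≫ fst A.obj B.obj)]
  simp

theorem rightPt_prod_snd {X : K} (x : X ⟶ prod A.obj B.obj) :
    ((PsMon.pair i j).rightPt x).hom ▷ snd A.obj B.obj =
      eqToHom (by rw [PsMonData.ten_prodMul_snd, Strict.assoc, pair_snd]) ≫
        (j.rightPt (x ≫ snd A.obj B.obj)).hom := by
  refine (MonHom.rightPt_whiskerRight (PsMon.snd A B) x).trans ?_
  rw [PsMon.snd_mulAt, MonHom.rightPt_congr
    (show (PsMon.pair i j).comp (PsMon.snd A B) = j from PsMon.pair_comp_snd i j)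
    (rfl : x ≫ (PsMon.snd A B).hom = x ≫ snd A.obj B.obj)]
  simp

theorem leftPt_prod_fst {X : K} (x : X ⟶ prod A.obj B.obj) :
    ((PsMon.pair i j).leftPt x).hom ▷ fst A.obj B.obj =
      eqToHom (by rw [PsMonData.ten_prodMul_fst, Strict.assoc, pair_fst]) ≫
        (i.leftPt (x ≫ fst A.obj B.obj)).hom := by
  refine (MonHom.leftPt_whiskerRight (PsMon.fst A B) x).trans ?_
  rw [PsMon.fst_mulAt, MonHom.leftPt_congr
    (show (PsMon.pair i j).comp (PsMon.fst A B) = i from PsMon.pair_comp_fst i j)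
    (rfl : x ≫ (PsMon.fst A B).hom = x ≫ fst A.obj B.obj)]
  simp

theorem leftPt_prod_snd {X : K} (x : X ⟶ prod A.obj B.obj) :
    ((PsMon.pair i j).leftPt x).hom ▷ snd A.obj B.obj =
      eqToHom (by rw [PsMonData.ten_prodMul_snd, Strict.assoc, pair_snd]) ≫
        (j.leftPt (x ≫ snd A.obj B.obj)).hom := by
  refine (MonHom.leftPt_whiskerRight (PsMon.snd A B) x).trans ?_
  rw [PsMon.snd_mulAt, MonHom.leftPt_congr
    (show (PsMon.pair i j).comp (PsMon.snd A B) = j from PsMon.pair_comp_snd i j)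
    (rfl : x ≫ (PsMon.snd A B).hom = x ≫ snd A.obj B.obj)]
  simp

/-- On the first factor the decomposition reads (a, 0) ⊗ (0, 0) ≅ (a, 0), which ought to be a right
unitor. In the second coordinate `split` uses a left unitor instead, evaluated at the point itself,
and there `leftPt_self` makes the two agree. -/
theorem inl_split : inl A.obj j.hom ◁ (split i j).hom =
    eqToHom (by rw [comp_ten, inl_fst_inl, inl_snd_inr]) ≫
      ((PsMon.pair i j).rightPt (inl A.obj j.hom)).hom ≫ eqToHom (Strict.comp_id _).symm := by
  refine hom_ext₂ ?_ ?_
  · rw [whisker_assoc', split_fst]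
    simp only [whiskerLeft_comp, whiskerLeft_eqToHom, comp_whiskerRight, eqToHom_whiskerRight,
      i.whiskerLeft_rightPt (inl A.obj j.hom) rfl, rightPt_prod_fst]
    simp
  · rw [whisker_assoc', split_snd]
    simp only [whiskerLeft_comp, whiskerLeft_eqToHom, comp_whiskerRight, eqToHom_whiskerRight,
      j.whiskerLeft_leftPt (inl A.obj j.hom) (inl_snd _), rightPt_prod_snd,
      MonHom.rightPt_congr (i := j) rfl (inl_snd (A := A.obj) j.hom),
      MonHom.leftPt_self]
    simp

theorem inr_split : inr B.obj i.hom ◁ (split i j).hom =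
    eqToHom (by rw [comp_ten, inr_snd_inr, inr_fst_inl]) ≫
      ((PsMon.pair i j).leftPt (inr B.obj i.hom)).hom ≫ eqToHom (Strict.comp_id _).symm := by
  refine hom_ext₂ ?_ ?_
  · rw [whisker_assoc', split_fst]
    simp only [whiskerLeft_comp, whiskerLeft_eqToHom, comp_whiskerRight, eqToHom_whiskerRight,
      i.whiskerLeft_rightPt (inr B.obj i.hom) (inr_fst _), leftPt_prod_fst,
      MonHom.leftPt_congr (i := i) rfl (inr_fst (B := B.obj) i.hom),
      ← MonHom.leftPt_self]
    simp
  · rw [whisker_assoc', split_snd]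
    simp only [whiskerLeft_comp, whiskerLeft_eqToHom, comp_whiskerRight, eqToHom_whiskerRight,
      j.whiskerLeft_leftPt (inr B.obj i.hom) rfl, leftPt_prod_snd]
    simp

end MonHom

end Split
-- 2-cells out of a product of pseudo monoids: uniqueness and gluing.
section Additivity

variable {K : Type u} [Bicategory.{w, v} K] [FiniteProducts K]

theorem tenMap_conj_snd {A : K} (m : prod A A ⟶ A) {X : K} {x x' y y' b b' : X ⟶ A} (η : x ⟶ x')
    (e₃ : b = y) (θ : y ⟶ y') (e₄ : y' = b') :
    tenMap m η (eqToHom e₃ ≫ θ ≫ eqToHom e₄) =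
      eqToHom (by rw [e₃]) ≫ tenMap m η θ ≫ eqToHom (by rw [e₄]) := by
  subst e₃ e₄; simp

theorem tenMap_conj_fst {A : K} (m : prod A A ⟶ A) {X : K} {x x' y y' a a' : X ⟶ A}
    (e₁ : a = x) (η : x ⟶ x') (e₂ : x' = a') (θ : y ⟶ y') :
    tenMap m (eqToHom e₁ ≫ η ≫ eqToHom e₂) θ =
      eqToHom (by rw [e₁]) ≫ tenMap m η θ ≫ eqToHom (by rw [e₂]) := by
  subst e₁ e₂; simp

variable [Bicategory.Strict K]

theorem comp_inr {A B : K} (i : one ⟶ A) (j : one ⟶ B) : j ≫ inr B i = pair i j := by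
  rw [inr, comp_pair, ← Strict.assoc, comp_bang, Strict.comp_id, ← bang_uniq (𝟙 one),
    Strict.id_comp]

theorem comp_inl {A B : K} (i : one ⟶ A) (j : one ⟶ B) : i ≫ inl A j = pair i j := by
  rw [inl, comp_pair, ← Strict.assoc, comp_bang, Strict.comp_id, ← bang_uniq (𝟙 one),
    Strict.id_comp]

namespace MonHom

section

variable {M N : PsMon K} {z : MonHom (PsMon.one : PsMon K) M} {g h : MonHom M N} {X : K}
  {x : X ⟶ M.obj} {c a : x ≫ g.hom ⟶ x ≫ h.hom}

/-- Tensoring `a` with a monoidal 2-cell at a point changes nothing after the unitors are removed.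
Monoidality of `ω` is essential, since an arbitrary 2-cell at the point would leave a residue. -/
theorem eq_of_rightPt (ω : MonCell (z.comp g) (z.comp h))
    (H : (z.rightPt x).hom ▷ g.hom ≫ c = (g.mulAt x (bang X ≫ z.hom)).hom ≫
      tenMap N.mul a
        (eqToHom (Strict.assoc _ _ _) ≫ bang X ◁ ω.cell ≫ eqToHom (Strict.assoc _ _ _).symm) ≫
      (h.mulAt x (bang X ≫ z.hom)).inv ≫ (z.rightPt x).hom ▷ h.hom) : c = a := by
  rw [← cancel_epi ((z.rightPt x).hom ▷ g.hom), H, rightPt_whiskerRight, rightPt_whiskerRight,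
    Iso.inv_hom_id_assoc, tenMap_conj_snd]
  simp only [Category.assoc, eqToHom_trans_assoc, eqToHom_refl, Category.id_comp]
  rw [rightPt_naturality ω a]

theorem eq_of_leftPt (ω : MonCell (z.comp g) (z.comp h))
    (H : (z.leftPt x).hom ▷ g.hom ≫ c = (g.mulAt (bang X ≫ z.hom) x).hom ≫
      tenMap N.mul
        (eqToHom (Strict.assoc _ _ _) ≫ bang X ◁ ω.cell ≫ eqToHom (Strict.assoc _ _ _).symm) a ≫
      (h.mulAt (bang X ≫ z.hom) x).inv ≫ (z.leftPt x).hom ▷ h.hom) : c = a := by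
  rw [← cancel_epi ((z.leftPt x).hom ▷ g.hom), H, leftPt_whiskerRight, leftPt_whiskerRight,
    Iso.inv_hom_id_assoc, tenMap_conj_fst]
  simp only [Category.assoc, eqToHom_trans_assoc, eqToHom_refl, Category.id_comp]
  rw [leftPt_naturality ω a]

end

variable {A B N : PsMon K} (i : MonHom (PsMon.one : PsMon K) A)
  (j : MonHom (PsMon.one : PsMon K) B) {g h : MonHom (PsMon.prod A B) N}

/-- Naturality along `split` moves the 2-cell to (a, 0) ⊗ (0, b), and compatibility with φ₂ breaks
it there into the tensor product of its two restrictions. -/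
theorem cell_ext_of_inl_inr {ζ ξ : MonCell g h}
    (hl : inl A.obj j.hom ◁ ζ.cell = inl A.obj j.hom ◁ ξ.cell)
    (hr : inr B.obj i.hom ◁ ζ.cell = inr B.obj i.hom ◁ ξ.cell) : ζ = ξ := by
  -- The identity 1-cell is introduced because it is the target of `split`, so that interchange with
  -- `split` applies.
  refine MonCell.ext (eq_of_whiskerLeft_id rfl ?_)
  have e := whisker_exchange (split i j).hom ζ.cell
  have e' := whisker_exchange (split i j).hom ξ.cell
  have m := MonCell.mulAt_cell ζ (fst A.obj B.obj ≫ inl A.obj j.hom)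
    (snd A.obj B.obj ≫ inr B.obj i.hom)
  have m' := MonCell.mulAt_cell ξ (fst A.obj B.obj ≫ inl A.obj j.hom)
    (snd A.obj B.obj ≫ inr B.obj i.hom)
  simp only [comp_whiskerLeft', hl, hr] at m
  simp only [comp_whiskerLeft'] at m'
  rw [← cancel_epi ((split i j).hom ▷ g.hom), ← e, ← e']
  congr 1
  rw [← cancel_mono (h.mulAt _ _).hom, m]
  exact m'.symm

variable (a : inl A.obj j.hom ≫ g.hom ⟶ inl A.obj j.hom ≫ h.hom)
  (b : inr B.obj i.hom ≫ g.hom ⟶ inr B.obj i.hom ≫ h.hom)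

/-- The `2`-cell on a product of pseudo monoids with given restrictions to the factors. -/
def glue : g.hom ⟶ h.hom :=
  eqToHom (Strict.id_comp _).symm ≫ (split i j).inv ▷ g.hom ≫ (g.mulAt _ _).hom ≫
    tenMap N.mul
      (eqToHom (Strict.assoc _ _ _) ≫ fst A.obj B.obj ◁ a ≫ eqToHom (Strict.assoc _ _ _).symm)
      (eqToHom (Strict.assoc _ _ _) ≫ snd A.obj B.obj ◁ b ≫ eqToHom (Strict.assoc _ _ _).symm) ≫
    (h.mulAt _ _).inv ≫ (split i j).hom ▷ h.hom ≫ eqToHom (Strict.id_comp _)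

theorem split_glue :
    (split i j).hom ▷ g.hom ≫ eqToHom (Strict.id_comp _) ≫ glue i j a b = (g.mulAt _ _).hom ≫
    tenMap N.mul
      (eqToHom (Strict.assoc _ _ _) ≫ fst A.obj B.obj ◁ a ≫ eqToHom (Strict.assoc _ _ _).symm)
      (eqToHom (Strict.assoc _ _ _) ≫ snd A.obj B.obj ◁ b ≫ eqToHom (Strict.assoc _ _ _).symm) ≫
    (h.mulAt _ _).inv ≫ (split i j).hom ▷ h.hom ≫ eqToHom (Strict.id_comp _) := by
  simp [glue]

/-- Restricted to the first factor, the glued cell is `a` tensored with the value of `b` at the base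
point, conjugated by right unitors. The hypothesis that this value underlies a monoidal `ω` makes
the second tensor factor invisible. -/
theorem inl_glue (ω : MonCell ((PsMon.pair i j).comp g) ((PsMon.pair i j).comp h))
    (hω : ω.cell = eqToHom (by rw [MonHomData.comp_hom, ← Strict.assoc, comp_inr]) ≫ j.hom ◁ b ≫
      eqToHom (by rw [MonHomData.comp_hom, ← Strict.assoc, comp_inr])) :
    inl A.obj j.hom ◁ glue i j a b = a := by
  have H := congrArg (inl A.obj j.hom ◁ ·) (split_glue i j a b)
  have e₁ := g.whiskerLeft_mulAt (inl A.obj j.hom) (inl_fst_inl (A := A.obj) j.hom)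
    (inl_snd_inr i.hom j.hom)
  have e₂ := h.whiskerLeft_mulAt_inv (inl A.obj j.hom) (inl_fst_inl (A := A.obj) j.hom)
    (inl_snd_inr i.hom j.hom)
  simp only [whiskerLeft_comp, whiskerLeft_whiskerRight, inl_split, e₁, e₂, whiskerLeft_tenMap,
    whiskerLeft_eqToHom, whiskerLeft_whiskerLeft (inl_fst j.hom),
    whiskerLeft_whiskerLeft (inl_snd (A := A.obj) j.hom), id_whiskerLeft', comp_whiskerRight,
    eqToHom_whiskerRight] at H
  simp only [Category.assoc, eqToHom_trans, eqToHom_trans_assoc, eqToHom_refl, Category.id_comp,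
    Category.comp_id, cancel_epi] at H
  -- `H` is `split_glue` restricted along `inl`, with `split` already replaced by the right unitor
  -- of the product.
  refine eq_of_rightPt ω (H.trans ?_)
  simp only [hω, comp_whiskerLeft' (bang A.obj) j.hom b, whiskerLeft_comp, whiskerLeft_eqToHom]
  simp only [Category.assoc, eqToHom_trans, eqToHom_trans_assoc, tenMap_conj,
    tenMap_conj_fst, tenMap_conj_snd, eqToHom_refl, Category.id_comp, Category.comp_id]

theorem inr_glue (ω : MonCell ((PsMon.pair i j).comp g) ((PsMon.pair i j).comp h))
    (hω : ω.cell = eqToHom (by rw [MonHomData.comp_hom, ← Strict.assoc, comp_inl]) ≫ i.hom ◁ a ≫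
      eqToHom (by rw [MonHomData.comp_hom, ← Strict.assoc, comp_inl])) :
    inr B.obj i.hom ◁ glue i j a b = b := by
  have H := congrArg (inr B.obj i.hom ◁ ·) (split_glue i j a b)
  have e₁ := g.whiskerLeft_mulAt (inr B.obj i.hom) (inr_fst_inl i.hom j.hom)
    (inr_snd_inr (B := B.obj) i.hom)
  have e₂ := h.whiskerLeft_mulAt_inv (inr B.obj i.hom) (inr_fst_inl i.hom j.hom)
    (inr_snd_inr (B := B.obj) i.hom)
  simp only [whiskerLeft_comp, whiskerLeft_whiskerRight, inr_split, e₁, e₂, whiskerLeft_tenMap,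
    whiskerLeft_eqToHom, whiskerLeft_whiskerLeft (inr_snd i.hom),
    whiskerLeft_whiskerLeft (inr_fst (B := B.obj) i.hom), id_whiskerLeft', comp_whiskerRight,
    eqToHom_whiskerRight] at H
  simp only [Category.assoc, eqToHom_trans, eqToHom_trans_assoc, eqToHom_refl, Category.id_comp,
    Category.comp_id, cancel_epi] at H
  refine eq_of_leftPt ω (H.trans ?_)
  simp only [hω, comp_whiskerLeft' (bang B.obj) i.hom a, whiskerLeft_comp, whiskerLeft_eqToHom]
  simp only [Category.assoc, eqToHom_trans, eqToHom_trans_assoc, tenMap_conj,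
    tenMap_conj_fst, tenMap_conj_snd, eqToHom_refl, Category.id_comp, Category.comp_id]

end MonHom

instance PsMon.prodFaithful : ProdFaithful (PsMon K) where
  ext i j _ _ _ _ hl hr := MonHom.cell_ext_of_inl_inr i j
    (congrArg (fun c => c.cell) hl) (congrArg (fun c => c.cell) hr)

/-- The hypotheses on the base are what upgrade the glued 2-cell to a monoidal one, and they cost
one extra level of iteration. No agreement of the two given cells at the base point has to be
assumed, since 2-cells between points of a pseudo monoid are unique. -/
instance PsMon.prodFull [PseudoPointed K] [ProdFaithful K] : ProdFull (PsMon K) where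
  exists_ext {A B X} i j {g h} α β := by
    have e (g : FiniteProducts.prod A B ⟶ X) :
        FiniteProducts.pair i j ≫ g = j ≫ inr B i ≫ g := by
      rw [← Strict.assoc, TwoCat.comp_inr]
    have e' (g : FiniteProducts.prod A B ⟶ X) :
        FiniteProducts.pair i j ≫ g = i ≫ inl A j ≫ g := by
      rw [← Strict.assoc, TwoCat.comp_inl]
    refine ⟨(MonCell.ofCell (MonHom.glue i j α.cell β.cell) : MonCell g h), ?_, ?_⟩
    -- The value of `β` at the base point is monoidal because the whiskering takes place among
    -- pseudo monoids; the equalities `e` only adjust its source and target to `pair i j`.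
    · refine PsMon.cell_ext (MonHom.inl_glue i j α.cell β.cell
        (eqToHom (e g) ≫ j ◁ β ≫ eqToHom (e h).symm : _ ⟶ _) ?_)
      rw [PsMon.comp_cell, PsMon.comp_cell, PsMon.eqToHom_cell, PsMon.eqToHom_cell]
      rfl
    · refine PsMon.cell_ext (MonHom.inr_glue i j α.cell β.cell
        (eqToHom (e' g) ≫ i ◁ α ≫ eqToHom (e' h).symm : _ ⟶ _) ?_)
      rw [PsMon.comp_cell, PsMon.comp_cell, PsMon.eqToHom_cell, PsMon.eqToHom_cell]
      rfl

end Additivity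
-- The associativity axiom at arguments containing a unit follows from the unit axioms.
section Coherence

variable {K : Type u} [Bicategory.{w, v} K] [Bicategory.Strict K] [FiniteProducts K]

namespace MonHomData

variable {X Y : K}

/-- Converse to `AssocAt.whisker`: it lets the axiom be tested on restrictions, in the form required
by `ProdFaithful.ext`. -/
theorem AssocAt.of_whisker {M N : PsMonData K} {f : MonHomData M N} {x y z : X ⟶ M.obj} (h : Y ⟶ X)
    (H : f.AssocAt (h ≫ x) (h ≫ y) (h ≫ z)) :
    h ◁ ((M.assocAt x y z).hom ▷ f.hom ≫ (f.mulAt x (ten M.mul y z)).hom ≫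
        tenMap N.mul (𝟙 (x ≫ f.hom)) (f.mulAt y z).hom) =
      h ◁ ((f.mulAt (ten M.mul x y) z).hom ≫ tenMap N.mul (f.mulAt x y).hom (𝟙 (z ≫ f.hom)) ≫
        (N.assocAt (x ≫ f.hom) (y ≫ f.hom) (z ≫ f.hom)).hom) := by
  simp only [whiskerLeft_comp, whiskerLeft_whiskerRight, whiskerLeft_tenMap, whiskerLeft_id,
    M.whiskerLeft_assocAt h (rfl : h ≫ x = h ≫ x) (rfl : h ≫ y = h ≫ y) (rfl : h ≫ z = h ≫ z),
    N.whiskerLeft_assocAt h (Strict.assoc h x f.hom).symm (Strict.assoc h y f.hom).symm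
      (Strict.assoc h z f.hom).symm,
    f.whiskerLeft_mulAt h (rfl : h ≫ x = h ≫ x) (comp_ten M.mul h y z),
    f.whiskerLeft_mulAt h (rfl : h ≫ y = h ≫ y) (rfl : h ≫ z = h ≫ z),
    f.whiskerLeft_mulAt h (comp_ten M.mul h x y) (rfl : h ≫ z = h ≫ z),
    f.whiskerLeft_mulAt h (rfl : h ≫ x = h ≫ x) (rfl : h ≫ y = h ≫ y),
    id_conj (Strict.assoc h x f.hom).symm, id_conj (Strict.assoc h z f.hom).symm, tenMap_conj,
    comp_whiskerRight, eqToHom_whiskerRight]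
  simp only [Category.assoc, eqToHom_trans, eqToHom_trans_assoc, eqToHom_refl, Category.id_comp,
    Category.comp_id, cancel_epi]
  simp only [← Category.assoc, cancel_mono]
  simpa [AssocAt] using H

variable {M N : PsMon K} {f : MonHomData M.toPsMonData N.toPsMonData}

/-- Once the invertible cell that removes the middle unit is appended, the triangle axioms of `M`
and `N` replace both associators by right unitors, and naturality of φ₂ with the two unit axioms
matches the remainder. -/
theorem assocAt_unit_mid {x z : X ⟶ M.obj} (hr : f.RightAt x) (hl : f.LeftAt z) :
    f.AssocAt x (bang X ≫ M.unit) z := by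
  have n₁ := f.mulAt_naturality (𝟙 x) (M.leftAt z).hom
  have n₂ := f.mulAt_naturality (M.rightAt x).hom (𝟙 z)
  have t := congrArg (· ▷ f.hom) (M.triangleAt x z)
  have t' := N.triangleAt (x ≫ f.hom) (z ≫ f.hom)
  have a := N.assocAt_naturality (𝟙 (x ≫ f.hom)) (f.unitAt X).hom (𝟙 (z ≫ f.hom))
  unfold RightAt at hr
  unfold LeftAt at hl
  unfold PsMonData.TriangleAt at t'
  simp only [comp_whiskerRight, id_whiskerRight] at t n₁ n₂
  unfold AssocAt
  rw [← cancel_mono (tenMap N.mul (𝟙 (x ≫ f.hom)) (tenMap N.mul (f.unitAt X).hom (𝟙 (z ≫ f.hom)) ≫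
    (N.leftAt (z ≫ f.hom)).hom))]
  have e₁ : tenMap N.mul (𝟙 (x ≫ f.hom)) (f.mulAt (bang X ≫ M.unit) z).hom ≫
      tenMap N.mul (𝟙 (x ≫ f.hom)) (tenMap N.mul (f.unitAt X).hom (𝟙 (z ≫ f.hom)) ≫
        (N.leftAt (z ≫ f.hom)).hom) = tenMap N.mul (𝟙 (x ≫ f.hom)) ((M.leftAt z).hom ▷ f.hom) := by
    rw [← tenMap_comp_right, hl]
  have e₂ : tenMap N.mul ((M.rightAt x).hom ▷ f.hom) (𝟙 (z ≫ f.hom)) =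
      tenMap N.mul (f.mulAt x (bang X ≫ M.unit)).hom (𝟙 (z ≫ f.hom)) ≫
      tenMap N.mul (tenMap N.mul (𝟙 (x ≫ f.hom)) (f.unitAt X).hom) (𝟙 (z ≫ f.hom)) ≫
      tenMap N.mul (N.rightAt (x ≫ f.hom)).hom (𝟙 (z ≫ f.hom)) := by
    rw [← tenMap_comp_left, ← tenMap_comp_left, hr]
  simp only [Category.assoc]
  rw [e₁, ← n₁, reassoc_of% t, n₂, e₂, tenMap_comp_right, ← t', reassoc_of% a]

/-- The same method, with `leftAt_ten` in the role of the triangle. The left unit axiom is needed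
both at `y` and at the product of `y` and `z`. -/
theorem assocAt_unit_left {y z : X ⟶ M.obj} (h : ∀ x : X ⟶ M.obj, f.LeftAt x) :
    f.AssocAt (bang X ≫ M.unit) y z := by
  have n₁ := N.leftAt_naturality (f.mulAt y z).hom
  have n₂ := f.mulAt_naturality (M.leftAt y).hom (𝟙 z)
  have t := congrArg (· ▷ f.hom) (leftAt_ten M y z)
  have t' := leftAt_ten N (y ≫ f.hom) (z ≫ f.hom)
  have a := N.assocAt_naturality (f.unitAt X).hom (𝟙 (y ≫ f.hom)) (𝟙 (z ≫ f.hom))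
  have h₁ := h y
  have h₂ := h (ten M.mul y z)
  unfold LeftAt at h₁ h₂
  simp only [comp_whiskerRight, id_whiskerRight, tenMap_id] at t n₂ a
  unfold AssocAt
  rw [← cancel_mono (tenMap N.mul (f.unitAt X).hom (𝟙 _) ≫ (N.leftAt _).hom)]
  have e₁ : tenMap N.mul (𝟙 ((bang X ≫ M.unit) ≫ f.hom)) (f.mulAt y z).hom ≫
      tenMap N.mul (f.unitAt X).hom (𝟙 _) =
      tenMap N.mul (f.unitAt X).hom (𝟙 _) ≫ tenMap N.mul (𝟙 _) (f.mulAt y z).hom := by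
    simp only [← tenMap_comp, Category.comp_id, Category.id_comp]
  have e₂ : tenMap N.mul ((M.leftAt y).hom ▷ f.hom) (𝟙 (z ≫ f.hom)) =
      tenMap N.mul (f.mulAt (bang X ≫ M.unit) y).hom (𝟙 (z ≫ f.hom)) ≫
      tenMap N.mul (tenMap N.mul (f.unitAt X).hom (𝟙 (y ≫ f.hom))) (𝟙 (z ≫ f.hom)) ≫
      tenMap N.mul (N.leftAt (y ≫ f.hom)).hom (𝟙 (z ≫ f.hom)) := by
    rw [← tenMap_comp_left, ← tenMap_comp_left, h₁]
  simp only [Category.assoc]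
  rw [reassoc_of% e₁, n₁, ← reassoc_of% h₂, reassoc_of% t, n₂, e₂, ← t', reassoc_of% a]

/-- Used when φ₂ comes from `ProdFull` and is known only through its restrictions to the factors. -/
theorem mulAt_hom_of_eq {M N : PsMonData K} (f : MonHomData M N) {x y : X ⟶ M.obj}
    {θ : ten M.mul x y ≫ f.hom ⟶ ten N.mul (x ≫ f.hom) (y ≫ f.hom)}
    (h : pair x y ◁ f.mulIso.hom = eqToHom (ten_comp M.mul x y f.hom).symm ≫ θ ≫
      eqToHom (f.comp_ten_hom x y).symm) : (f.mulAt x y).hom = θ := by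
  rw [mulAt_hom, h]
  simp

theorem RightAt.of_id {M N : PsMonData K} {f : MonHomData M N} (h : f.RightAt (𝟙 M.obj))
    (x : X ⟶ M.obj) : f.RightAt x := by
  simpa only [Strict.comp_id] using h.whisker x

theorem LeftAt.of_id {M N : PsMonData K} {f : MonHomData M N} (h : f.LeftAt (𝟙 M.obj))
    (x : X ⟶ M.obj) : f.LeftAt x := by
  simpa only [Strict.comp_id] using h.whisker x

end MonHomData

end Coherence

/-! ### Every 1-cell acquires a strong monoidal structure. -/

section Lift

variable {K : Type u} [Bicategory.{w, v} K] [FiniteProducts K]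

theorem exists_iso_of_pointed [PseudoPointed K] {X : K} (f g : (one : K) ⟶ X) : Nonempty (f ≅ g) := by
  obtain ⟨η⟩ := PseudoPointed.exists_cell f g
  obtain ⟨θ⟩ := PseudoPointed.exists_cell g f
  exact ⟨⟨η, θ, PseudoPointed.cell_ext _ _, PseudoPointed.cell_ext _ _⟩⟩

/-- The inverses on the factors extend as well, and faithfulness verifies on each factor that the
two extensions are mutually inverse. -/
theorem exists_iso_of_prodFull [ProdFaithful K] [ProdFull K] {A B X : K} (i : one ⟶ A)
    (j : one ⟶ B) {g h : prod A B ⟶ X} (α : inl A j ≫ g ≅ inl A j ≫ h)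
    (β : inr B i ≫ g ≅ inr B i ≫ h) :
    ∃ ζ : g ≅ h, inl A j ◁ ζ.hom = α.hom ∧ inr B i ◁ ζ.hom = β.hom := by
  obtain ⟨ζ, h₁, h₂⟩ := ProdFull.exists_ext i j α.hom β.hom
  obtain ⟨ξ, k₁, k₂⟩ := ProdFull.exists_ext i j α.inv β.inv
  refine ⟨⟨ζ, ξ, ProdFaithful.ext i j ?_ ?_, ProdFaithful.ext i j ?_ ?_⟩, h₁, h₂⟩ <;>
    simp [h₁, h₂, k₁, k₂]

variable [Bicategory.Strict K]

/-- Existence half of Eckmann–Hilton. Pointedness supplies φ₀, and the unit axioms then dictate φ₂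
when either argument is the unit, which is exactly the data from which fullness builds φ₂. -/
theorem exists_monHom [PseudoPointed K] [ProdFaithful K] [ProdFull K] {M N : PsMon K}
    (f : M.obj ⟶ N.obj) : ∃ F : MonHom M N, F.hom = f := by
  obtain ⟨φ₀⟩ := exists_iso_of_pointed (M.unit ≫ f) N.unit
  let u : (bang M.obj ≫ M.unit) ≫ f ≅ bang M.obj ≫ N.unit :=
    eqToIso (Strict.assoc _ _ _) ≪≫ whiskerLeftIso (bang M.obj) φ₀
  have et (x y : M.obj ⟶ M.obj) :
      pair x y ≫ ten N.mul (fst M.obj M.obj ≫ f) (snd M.obj M.obj ≫ f) =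
        ten N.mul (x ≫ f) (y ≫ f) := by
    simp only [comp_ten, pair_fst_comp, pair_snd_comp]
  -- The two prescribed restrictions are the right and left unit axioms solved for φ₂.
  obtain ⟨φ₂, h₁, h₂⟩ := exists_iso_of_prodFull M.unit M.unit
    (g := M.mul ≫ f) (h := ten N.mul (fst M.obj M.obj ≫ f) (snd M.obj M.obj ≫ f))
    (eqToIso (ten_comp M.mul _ _ f).symm ≪≫ (whiskerRightIso (M.rightAt (𝟙 M.obj)) f ≪≫
      (N.rightAt (𝟙 M.obj ≫ f)).symm ≪≫ tenMapIso N.mul (Iso.refl _) u.symm) ≪≫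
      eqToIso (et _ _).symm)
    (eqToIso (ten_comp M.mul _ _ f).symm ≪≫ (whiskerRightIso (M.leftAt (𝟙 M.obj)) f ≪≫
      (N.leftAt (𝟙 M.obj ≫ f)).symm ≪≫ tenMapIso N.mul u.symm (Iso.refl _)) ≪≫
      eqToIso (et _ _).symm)
  let F : MonHomData M.toPsMonData N.toPsMonData := ⟨f, φ₀, φ₂⟩
  have hr : F.RightAt (𝟙 M.obj) := by
    have e : (F.mulAt (𝟙 M.obj) (bang M.obj ≫ M.unit)).hom = (M.rightAt (𝟙 M.obj)).hom ▷ F.hom ≫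
        (N.rightAt (𝟙 M.obj ≫ F.hom)).inv ≫ tenMap N.mul (𝟙 _) (F.unitAt M.obj).inv :=
      F.mulAt_hom_of_eq h₁
    unfold MonHomData.RightAt
    rw [e]
    simp only [Category.assoc]
    rw [← Category.assoc (tenMap _ _ _), ← tenMap_comp_right]
    simp
  have hl : F.LeftAt (𝟙 M.obj) := by
    have e : (F.mulAt (bang M.obj ≫ M.unit) (𝟙 M.obj)).hom = (M.leftAt (𝟙 M.obj)).hom ▷ F.hom ≫
        (N.leftAt (𝟙 M.obj ≫ F.hom)).inv ≫ tenMap N.mul (F.unitAt M.obj).inv (𝟙 _) :=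
      F.mulAt_hom_of_eq h₂
    unfold MonHomData.LeftAt
    rw [e]
    simp only [Category.assoc]
    rw [← Category.assoc (tenMap _ _ _), ← tenMap_comp_left]
    simp
  refine ⟨⟨F, ?_, hl, hr⟩, rfl⟩
  -- The triple product is split once, as first factor against the remaining two. Its restrictions
  -- are the triples (x, 1, 1) and (1, y, z), where 1 is the unit, so the middle-unit and left-unit
  -- cases suffice.
  refine ProdFaithful.ext M.unit (pair M.unit M.unit)
    (MonHomData.AssocAt.of_whisker _ ?_) (MonHomData.AssocAt.of_whisker _ ?_)
  · have e₁ : inl M.obj (pair M.unit M.unit) ≫ snd M.obj (prod M.obj M.obj) ≫ fst M.obj M.obj =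
        bang M.obj ≫ M.unit := by
      rw [← Strict.assoc, inl_snd, Strict.assoc, pair_fst]
    have e₂ : inl M.obj (pair M.unit M.unit) ≫ snd M.obj (prod M.obj M.obj) ≫ snd M.obj M.obj =
        bang M.obj ≫ M.unit := by
      rw [← Strict.assoc, inl_snd, Strict.assoc, pair_snd]
    rw [e₁, e₂]
    exact MonHomData.assocAt_unit_mid (hr.of_id _) (hl.of_id _)
  · rw [inr_fst]
    exact MonHomData.assocAt_unit_left fun x => hl.of_id x

end Lift
-- A pseudo monoid as a pseudo monoid over itself.
section Lifting

variable {K : Type u} [Bicategory.{w, v} K] [Bicategory.Strict K] [FiniteProducts K]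

section Underlying

variable {A B M N : PsMon K}

theorem lift₂_cell {h k : M ⟶ prod A B} (η : h ≫ fst A B ⟶ k ≫ fst A B)
    (θ : h ≫ snd A B ⟶ k ≫ snd A B) : (lift₂ η θ).cell =
      (lift₂ (A := A.obj) (B := B.obj) (h := h.hom) (k := k.hom) η.cell θ.cell : _ ⟶ _) :=
  rfl

theorem pairMap_cell {f f' : M ⟶ A} {g g' : M ⟶ B} (η : f ⟶ f') (θ : g ⟶ g') :
    (pairMap η θ).cell = pairMap η.cell θ.cell := by
  rw [pairMap, lift₂_cell]
  simp only [PsMon.comp_cell, PsMon.eqToHom_cell]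
  rfl

theorem tenMap_cell (m : prod A A ⟶ A) {x x' y y' : M ⟶ A} (η : x ⟶ x') (θ : y ⟶ y') :
    (tenMap m η θ).cell = tenMap m.hom η.cell θ.cell :=
  congrArg (· ▷ m.hom) (pairMap_cell η θ)

/-- The underlying isomorphism of an invertible monoidal `2`-cell. -/
def cellIso {f g : M ⟶ N} (e : f ≅ g) : f.hom ≅ g.hom where
  hom := e.hom.cell
  inv := e.inv.cell
  hom_inv_id := congrArg (fun c => c.cell) e.hom_inv_id
  inv_hom_id := congrArg (fun c => c.cell) e.inv_hom_id

/-- The pseudo monoid data underlying pseudo monoid data in the `2`-category of pseudo monoids. -/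
def underlying (N : PsMonData (PsMon K)) : PsMonData K where
  obj := N.obj.obj
  unit := N.unit.hom
  mul := N.mul.hom
  assoc := cellIso N.assoc
  leftUnit := cellIso N.leftUnit
  rightUnit := cellIso N.rightUnit

variable (P : PsMonData (PsMon K))

theorem assocAt_cell (x y z : M ⟶ P.obj) :
    (P.assocAt x y z).hom.cell = ((underlying P).assocAt x.hom y.hom z.hom).hom := by
  simp only [PsMonData.assocAt, Iso.trans_hom, eqToIso.hom, PsMon.comp_cell, PsMon.eqToHom_cell]
  rfl

theorem leftAt_cell (x : M ⟶ P.obj) :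
    (P.leftAt x).hom.cell = ((underlying P).leftAt x.hom).hom := by
  simp only [PsMonData.leftAt, Iso.trans_hom, eqToIso.hom, PsMon.comp_cell, PsMon.eqToHom_cell]
  rfl

theorem rightAt_cell (x : M ⟶ P.obj) :
    (P.rightAt x).hom.cell = ((underlying P).rightAt x.hom).hom := by
  simp only [PsMonData.rightAt, Iso.trans_hom, eqToIso.hom, PsMon.comp_cell, PsMon.eqToHom_cell]
  rfl

variable {P}

/-- Monoidal 2-cells are equal when their underlying 2-cells are, and all the constraints are
computed underneath, so the axiom may be checked in the base. -/
theorem PentagonAt.of_underlying {w x y z : M ⟶ P.obj}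
    (h : (underlying P).PentagonAt w.hom x.hom y.hom z.hom) : P.PentagonAt w x y z := by
  refine PsMon.cell_ext ?_
  simp only [PsMon.comp_cell, tenMap_cell, assocAt_cell, PsMon.id_cell]
  exact h

theorem TriangleAt.of_underlying {x y : M ⟶ P.obj}
    (h : (underlying P).TriangleAt x.hom y.hom) : P.TriangleAt x y := by
  refine PsMon.cell_ext ?_
  simp only [PsMon.comp_cell, tenMap_cell, assocAt_cell, leftAt_cell, rightAt_cell, PsMon.id_cell]
  exact h

end Underlying

/-- Invertible `2`-cells between strong monoidal morphisms are monoidal. -/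
def MonCell.isoOfCell [PseudoPointed K] [ProdFaithful K] {M N : PsMon K} {f g : M ⟶ N}
    (η : f.hom ≅ g.hom) : f ≅ g where
  hom := MonCell.ofCell η.hom
  inv := MonCell.ofCell η.inv
  hom_inv_id := MonCell.ext η.hom_inv_id
  inv_hom_id := MonCell.ext η.inv_hom_id

variable [PseudoPointed K] [ProdFaithful K] [ProdFull K]

/-- Existence is rephrased as existence of structure cells on the given `f`, so that the chosen
morphism has `f` as its underlying 1-cell by definition. The structure cells of `M` then typecheck
unchanged in `doubleData`. -/
theorem exists_monHom_structure {M N : PsMon K} (f : M.obj ⟶ N.obj) :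
    ∃ (φ₀ : M.unit ≫ f ≅ N.unit)
      (φ₂ : M.mul ≫ f ≅ ten N.mul (fst M.obj M.obj ≫ f) (snd M.obj M.obj ≫ f)),
      ∃ F : MonHom M N, F.toMonHomData = ⟨f, φ₀, φ₂⟩ := by
  obtain ⟨F, rfl⟩ := exists_monHom f
  exact ⟨_, _, F, rfl⟩

/-- The strong monoidal morphism with a given underlying `1`-cell. -/
noncomputable def liftMonHom {M N : PsMon K} (f : M.obj ⟶ N.obj) : MonHom M N :=
  have h := (exists_monHom_structure f).choose_spec.choose_spec
  { hom := f
    unitIso := (exists_monHom_structure f).choose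
    mulIso := (exists_monHom_structure f).choose_spec.choose
    assoc := h.choose_spec ▸ h.choose.assoc
    left := h.choose_spec ▸ h.choose.left
    right := h.choose_spec ▸ h.choose.right }

/-- The data of a pseudo monoid on a pseudo monoid, with the same structure cells. -/
noncomputable def doubleData (M : PsMon K) : PsMonData (PsMon K) where
  obj := M
  unit := liftMonHom (M := PsMon.one) M.unit
  mul := liftMonHom (M := PsMon.prod M M) M.mul
  assoc := MonCell.isoOfCell M.assoc
  leftUnit := MonCell.isoOfCell M.leftUnit
  rightUnit := MonCell.isoOfCell M.rightUnit

/-- Every pseudo monoid is a pseudo monoid in the `2`-category of pseudo monoids. -/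
noncomputable def double (M : PsMon K) : PsMon (PsMon K) where
  toPsMonData := doubleData M
  -- The data underlying `doubleData M` is definitionally that of `M`, so its own axioms serve.
  pentagon := PentagonAt.of_underlying (P := doubleData M) M.pentagon
  triangle := TriangleAt.of_underlying (P := doubleData M) M.triangle

end Lifting

/-! ### The inverse 2-functor and the two 2-natural isomorphisms. -/

section Equivalence

variable (K : Type u) [Bicategory.{w, v} K] [Bicategory.Strict K] [FiniteProducts K]
  [PseudoPointed K] [ProdFaithful K] [ProdFull K]

/-- The `2`-functor that repeats the pseudo monoid structure. -/
noncomputable def doubleFunctor : StrictPseudofunctor (PsMon K) (PsMon (PsMon K)) :=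
  StrictPseudofunctor.mk''
    { obj := fun M => double M
      map := fun {M N} f =>
        -- The lift takes place over `PsMon K`, which again satisfies all three conditions.
        (liftMonHom (M := double M) (N := double N) f : double M ⟶ double N)
      map₂ := fun {M N f g} η => MonCell.ofCell (M := double M) (N := double N)
        (f := liftMonHom (M := double M) (N := double N) f)
        (g := liftMonHom (M := double M) (N := double N) g) η
      map₂_id := fun _ => MonCell.ext rfl
      map₂_comp := fun _ _ => MonCell.ext rfl
      -- Strict functoriality despite the choices in the lift: strong monoidal structures on a fixed
      -- 1-cell are unique.
      map_id := fun _ => MonHom.ext_hom rfl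
      map_comp := fun _ _ => MonHom.ext_hom rfl
      map₂_whisker_left := by
        intros
        refine PsMon.cell_ext ?_
        rw [PsMon.comp_cell, PsMon.comp_cell, PsMon.eqToHom_cell, PsMon.eqToHom_cell]
        exact ((Category.id_comp _).trans (Category.comp_id _)).symm
      map₂_whisker_right := by
        intros
        refine PsMon.cell_ext ?_
        rw [PsMon.comp_cell, PsMon.comp_cell, PsMon.eqToHom_cell, PsMon.eqToHom_cell]
        exact ((Category.id_comp _).trans (Category.comp_id _)).symm }

/-- Forgetting a pseudo monoid structure and repeating the remaining one is isomorphic to the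
identity. -/
noncomputable def forgetCompDoubleIso :
    TwoNatIso ((forget (PsMon K)).comp (doubleFunctor K)) (StrictPseudofunctor.id _) where
  -- The heart of Eckmann–Hilton: the outer structure of `M` and the repeated inner one live on the
  -- same object, and the identity 1-cell is strong monoidal between them in both directions.
  hom M := liftMonHom (M := double M.obj) (N := M) (𝟙 M.obj)
  inv M := liftMonHom (M := M) (N := double M.obj) (𝟙 M.obj)
  hom_inv M := MonHom.ext_hom (Strict.id_comp (𝟙 M.obj))
  inv_hom M := MonHom.ext_hom (Strict.id_comp (𝟙 M.obj))
  naturality f := MonHom.ext_hom ((Strict.comp_id f.hom).trans (Strict.id_comp f.hom).symm)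
  naturality₂ {M N f g} η := by
    refine PsMon.cell_ext ?_
    rw [PsMon.comp_cell, PsMon.comp_cell, PsMon.eqToHom_cell, PsMon.eqToHom_cell]
    have : η.cell ▷ 𝟙 N.obj ≫ eqToHom ((Strict.comp_id g.hom).trans (Strict.id_comp g.hom).symm) =
        eqToHom ((Strict.comp_id f.hom).trans (Strict.id_comp f.hom).symm) ≫ 𝟙 M.obj ◁ η.cell := by
      rw [whiskerRight_id', id_whiskerLeft']
      simp
    exact this

/-- Repeating a pseudo monoid structure and forgetting the copy is isomorphic to the identity. -/
noncomputable def doubleCompForgetIso :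
    TwoNatIso ((doubleFunctor K).comp (forget (PsMon K))) (StrictPseudofunctor.id _) where
  -- This composite returns every object, 1-cell and 2-cell unchanged by definition.
  hom M := 𝟙 M
  inv M := 𝟙 M
  hom_inv M := Strict.id_comp (𝟙 M)
  inv_hom M := Strict.id_comp (𝟙 M)
  naturality f := (Strict.comp_id f).trans (Strict.id_comp f).symm
  naturality₂ {M N f g} η := by
    have : η ▷ 𝟙 N ≫ eqToHom ((Strict.comp_id g).trans (Strict.id_comp g).symm) =
        eqToHom ((Strict.comp_id f).trans (Strict.id_comp f).symm) ≫ 𝟙 M ◁ η := by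
      rw [whiskerRight_id', id_whiskerLeft']
      simp
    exact this

end Equivalence

end TwoCat

/-- The general equivalence is applied over the twice iterated 2-category. The outer `PsMon` makes
it pointed and faithful over any base; fullness also needs these two properties of the inner `PsMon
K`. -/
theorem mainTheorem3 {K : Type u} [Bicategory.{w, v} K] [Bicategory.Strict K]
    [TwoCat.FiniteProducts K] :
    TwoCat.IsTwoEquivalence
      (TwoCat.forget (TwoCat.PsMon (TwoCat.PsMon (TwoCat.PsMon K)))) :=
  ⟨TwoCat.doubleFunctor (TwoCat.PsMon (TwoCat.PsMon K)),
    ⟨TwoCat.forgetCompDoubleIso (TwoCat.PsMon (TwoCat.PsMon K))⟩,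
    ⟨TwoCat.doubleCompForgetIso (TwoCat.PsMon (TwoCat.PsMon K))⟩⟩
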